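/- All digraphs are finite. A digraph $H$ may have loops and parallel arcs, and $|H|=|V(H)|+|E(H)|$. A digraph $T$ is \emph{semi-complete} if it has no loops, has at most one arc $(x,y)$ for every ordered pair of distinct vertices, and has at least one of the arcs $(x,y),(y,x)$ for all distinct $x,y$. An \emph{immersion} of $H$ into $T$ maps the vertices of $H$ injectively to vertices of $T$, every non-loop arc $(u,w)$ of $H$ to a directed path of $T$ from the image of $u$ to the image of $w$, and every loop at $u$ to a directed cycle of $T$ through the image of $u$, such that these paths and cycles are pairwise arc-disjoint. For distinct vertices $u_1,\dots,u_t$ of $H$ and distinct vertices $v_1,\dots,v_t$ of $T$, the instance $((H;u_1,\dots,u_t),(T;v_1,\dots,v_t))$ of the rooted immersion problem is a YES instance if there is an immersion of $H$ into $T$ that maps $u_i$ to $v_i$ for all $i$. A \emph{$q$-triple} of $T$ consists of pairwise disjoint sets $A,B,C\subseteq V(T)$ of size $q$ with orderings $(a_i),(b_i),(c_i)$, $1\le i\le q$, of their elements such that $(a_i,b_j),(b_i,c_j)\in E(T)$ for all $i,j$ and $(c_i,a_i)\in E(T)$ for all $i$. Let $p(k)=80k^2+80k+5$. \textbf{Lemma.}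 There is an algorithm with the following property. Its input is an instance $\mathcal I=((H;u_1,\dots,u_t),(T;v_1,\dots,v_t))$ of the rooted immersion problem, where $T$ is semi-complete and given by its adjacency matrix, together with lists, in any order, of the elements of sets $A,B,C$ that form a $p(k)$-triple $(A,B,C)$ of $T$ disjoint from $\{v_1,\dots,v_t\}$, where $k=|H|$. In time $O(p(k)^2|V(T)|^2)$, with an absolute implied constant, on a random access machine with words of $O(\log|V(T)|)$ bits, it finds a vertex $x\in B$ such that $\mathcal I$ is a YES instance if and only if $((H;u_1,\dots,u_t),(T\setminus\{x\};v_1,\dots,v_t))$ is a YES instance. -/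

import Mathlib

/-! ### Digraphs -/

/-- A digraph with vertex set `V` and arc set `E`, possibly with loops and parallel arcs:
the arc `e` leads from `src e` to `tgt e`. -/
structure MultiDigraph (V E : Type*) where
  src : E → V
  tgt : E → V

namespace Digraph

/-- A simple digraph (arcs are ordered pairs, no loops) in which any two distinct vertices are
joined by at least one arc; both opposite arcs may be present. -/
def IsSemicomplete {V : Type*} (T : Digraph V) : Prop :=
  (∀ x, ¬ T.Adj x x) ∧ ∀ x y, x ≠ y → T.Adj x y ∨ T.Adj y x

/-- The digraph `T ∖ {x}`. -/
def deleteVertex {V : Type*} (T : Digraph V) (x : V) : Digraph {y : V // y ≠ x} where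
  Adj y z := T.Adj y.1 z.1

/-- The list `l = [w₀, …, wₗ]` of vertices is a directed path of `T` from `x` to `y`. -/
def IsDirectedPath {V : Type*} (T : Digraph V) (x y : V) (l : List V) : Prop :=
  l.IsChain T.Adj ∧ l.Nodup ∧ l.head? = some x ∧ l.getLast? = some y

/-- The list `l = [x, w₁, …, wₗ = x]` of vertices is a directed cycle of `T` passing
through `x`: the only repetition is that it starts and ends in `x`. -/
def IsDirectedCycleThrough {V : Type*} (T : Digraph V) (x : V) (l : List V) : Prop :=
  l.IsChain T.Adj ∧ 2 ≤ l.length ∧ l.tail.Nodup ∧ l.head? = some x ∧ l.getLast? = some x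

/-- `(A, B, C)` is a `q`-triple of `T`: the sets are disjoint and have orderings
`a₁, …, a_q`, `b₁, …, b_q`, `c₁, …, c_q` such that all arcs `(aᵢ, bⱼ)`, `(bᵢ, cⱼ)` and all arcs
`(cᵢ, aᵢ)` are present. -/
def IsTriple {V : Type*} (T : Digraph V) (q : ℕ) (A B C : Finset V) : Prop :=
  Disjoint A B ∧ Disjoint B C ∧ Disjoint A C ∧
  ∃ a b c : Fin q → V,
    Function.Injective a ∧ Function.Injective b ∧ Function.Injective c ∧
    Set.range a = (A : Set V) ∧ Set.range b = (B : Set V) ∧ Set.range c = (C : Set V) ∧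
    (∀ i j, T.Adj (a i) (b j)) ∧ (∀ i j, T.Adj (b i) (c j)) ∧ ∀ i, T.Adj (c i) (a i)

end Digraph

/-- The list `l` of vertices traverses the arc `(x, y)`. -/
def TraversesArc {V : Type*} (l : List V) (x y : V) : Prop := [x, y] <:+: l

/-- `φ` (on vertices) and `P` (on arcs) form an immersion of `H` into `T`: distinct vertices have
distinct images, every non-loop arc is mapped to a directed path between the images of its ends,
every loop to a directed cycle through the image of its end, and the images of distinct arcs
have no arc in common. -/
def IsImmersion {U E V : Type*} (H : MultiDigraph U E) (T : Digraph V)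
    (φ : U → V) (P : E → List V) : Prop :=
  Function.Injective φ ∧
  (∀ e, H.src e ≠ H.tgt e → T.IsDirectedPath (φ (H.src e)) (φ (H.tgt e)) (P e)) ∧
  (∀ e, H.src e = H.tgt e → T.IsDirectedCycleThrough (φ (H.src e)) (P e)) ∧
  ∀ e f, e ≠ f → ∀ x y, ¬ (TraversesArc (P e) x y ∧ TraversesArc (P f) x y)

/-- The rooted digraph `(T; v₁, …, v_t)` admits an immersion of the rooted digraph
`(H; u₁, …, u_t)`, that is, an immersion sending each `uᵢ` to `vᵢ`. -/
def HasRootedImmersion {U E V : Type*} {t : ℕ} (H : MultiDigraph U E) (u : Fin t → U)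
    (T : Digraph V) (v : Fin t → V) : Prop :=
  ∃ (φ : U → V) (P : E → List V), IsImmersion H T φ P ∧ ∀ i, φ (u i) = v i

/-- `p(k) = 80k² + 80k + 5`. -/
def tripleSize (k : ℕ) : ℕ := 80 * k ^ 2 + 80 * k + 5

/-! ### Word random access machine

The memory consists of cells `M 0, M 1, …`, each holding a word, i.e. a natural number below a
bound `W`. The input is a read-only table of words, given by its rows. A program is built from
elementary instructions by sequencing, branching and looping. Each elementary instruction and each
test of a condition takes one step. -/

/-- Programs. The numbers `r s s'` are addresses of memory cells. -/
inductive RAMProgram : Type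
  /-- Do nothing. -/
  | skip
  /-- `M r := a` -/
  | const (r a : ℕ)
  /-- `M r := M s + M s'` -/
  | add (r s s' : ℕ)
  /-- `M r := M s - M s'`, truncated at zero. -/
  | sub (r s s' : ℕ)
  /-- `M r := M s * M s'` -/
  | mul (r s s' : ℕ)
  /-- `M r := M (M s)` -/
  | load (r s : ℕ)
  /-- `M (M r) := M s` -/
  | store (r s : ℕ)
  /-- `M r :=` the entry number `M s'` of the row number `M s` of the input (zero if there is no
  such entry). -/
  | read (r s s' : ℕ)
  /-- Sequential composition. -/
  | seq (P Q : RAMProgram)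
  /-- If `M r ≠ 0` then `P` else `Q`. -/
  | ite (r : ℕ) (P Q : RAMProgram)
  /-- While `M r ≠ 0` do `P`. -/
  | loop (r : ℕ) (P : RAMProgram)

/-- `RAMExec I W P M τ M'`: on input `I`, with words below `W`, the program `P` started with
memory `M` halts after exactly `τ` steps with memory `M'`. An instruction whose result is not
below `W` has no execution. -/
inductive RAMExec (I : List (List ℕ)) (W : ℕ) :
    RAMProgram → (ℕ → ℕ) → ℕ → (ℕ → ℕ) → Prop
  | skip (M : ℕ → ℕ) : RAMExec I W .skip M 1 M
  | const (M : ℕ → ℕ) (r a : ℕ) (h : a < W) :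
      RAMExec I W (.const r a) M 1 (Function.update M r a)
  | add (M : ℕ → ℕ) (r s s' : ℕ) (h : M s + M s' < W) :
      RAMExec I W (.add r s s') M 1 (Function.update M r (M s + M s'))
  | sub (M : ℕ → ℕ) (r s s' : ℕ) (h : M s - M s' < W) :
      RAMExec I W (.sub r s s') M 1 (Function.update M r (M s - M s'))
  | mul (M : ℕ → ℕ) (r s s' : ℕ) (h : M s * M s' < W) :
      RAMExec I W (.mul r s s') M 1 (Function.update M r (M s * M s'))
  | load (M : ℕ → ℕ) (r s : ℕ) (h : M (M s) < W) :
      RAMExec I W (.load r s) M 1 (Function.update M r (M (M s)))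
  | store (M : ℕ → ℕ) (r s : ℕ) (h : M s < W) :
      RAMExec I W (.store r s) M 1 (Function.update M (M r) (M s))
  | read (M : ℕ → ℕ) (r s s' : ℕ) (h : (I.getD (M s) []).getD (M s') 0 < W) :
      RAMExec I W (.read r s s') M 1
        (Function.update M r ((I.getD (M s) []).getD (M s') 0))
  | seq {P Q : RAMProgram} {M M' M'' : ℕ → ℕ} {τ τ' : ℕ}
      (hP : RAMExec I W P M τ M') (hQ : RAMExec I W Q M' τ' M'') :
      RAMExec I W (.seq P Q) M (τ + τ') M''
  | iteTrue {P Q : RAMProgram} {M M' : ℕ → ℕ} {τ r : ℕ}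
      (hr : M r ≠ 0) (hP : RAMExec I W P M τ M') :
      RAMExec I W (.ite r P Q) M (1 + τ) M'
  | iteFalse {P Q : RAMProgram} {M M' : ℕ → ℕ} {τ r : ℕ}
      (hr : M r = 0) (hQ : RAMExec I W Q M τ M') :
      RAMExec I W (.ite r P Q) M (1 + τ) M'
  | loopTrue {P : RAMProgram} {M M' M'' : ℕ → ℕ} {τ τ' r : ℕ}
      (hr : M r ≠ 0) (hP : RAMExec I W P M τ M')
      (hL : RAMExec I W (.loop r P) M' τ' M'') :
      RAMExec I W (.loop r P) M (1 + τ + τ') M''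
  | loopFalse {P : RAMProgram} {M : ℕ → ℕ} {r : ℕ} (hr : M r = 0) :
      RAMExec I W (.loop r P) M 1 M

open Classical in
/-- The input table of the algorithm. Row 0: the numbers `|V(T)|`, `|V(H)|`, `|E(H)|`, `t` and
`|B|`; rows 1, 2, 3: lists of the elements of `A`, `B`, `C`; rows 4, 5: the tails and the heads of
the arcs of `H`; rows 6, 7: the roots in `H` and in `T`; row `8 + x`: the row of the vertex `x` in
the adjacency matrix of `T`. -/
noncomputable def encodeInput {n m s t : ℕ} (H : MultiDigraph (Fin m) (Fin s))
    (u : Fin t → Fin m) (T : Digraph (Fin n)) (v : Fin t → Fin n)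
    (LA LB LC : List (Fin n)) : List (List ℕ) :=
  [[n, m, s, t, LB.length],
    LA.map Fin.val, LB.map Fin.val, LC.map Fin.val,
    List.ofFn fun e => (H.src e).val, List.ofFn fun e => (H.tgt e).val,
    List.ofFn fun i => (u i).val, List.ofFn fun i => (v i).val] ++
  List.ofFn fun x : Fin n => List.ofFn fun y : Fin n => if T.Adj x y then 1 else 0

/-! ### Elementary counting: union bounds and avoidance of few bad elements. -/

section Counting

/-! Write `k = |H|` and `q = p(k)`. A vertex is rich if there are many arcs from it into `B`, or a
large matching from its outneighbours into `B`. The same notion is used in the reversed digraph. The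
vertex `x ∈ B` to be deleted is one all of whose inneighbours are rich and all of whose
outneighbours are rich in the reversed digraph.

Such an `x` is irrelevant (`hasRootedImmersion_deleteVertex_iff`). View an immersion as a system of
arc-disjoint walks and choose one of least total weight, where each visit to `x` costs eleven and
each visit to another vertex costs one. Long segments of a walk between vertices of `B` can be
shortcut through a segment `b → c j → a j → b'`, so by minimality each walk meets `B` in at most
four vertices and uses at most four of the arcs from `c j` to `a j`
(`IsMinimalWalkSystem.card_visited_le`, `IsMinimalWalkSystem.card_return_le`). Hence almost all of
the triple is free. If a walk passes `y, x, z`, richness gives free routes with at most one inner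
vertex from `y` to some `b` and from some `b'` to `z`, and a free segment joins `b` to `b'`. The
detour costs at most six instead of eleven, a contradiction (`IsMinimalWalkSystem.notMem`). If `x`
is the image of a vertex of `H`, that image is moved to an unused vertex of `B`.

Such an `x` exists because poor vertices reach at most `40k²` vertices of `B` in each direction
(`card_reached_by_poor_le`). Take a maximal matching from poor vertices into `B`. Its left ends
induce a semicomplete digraph in which poverty bounds every outdegree, so it is small. Every reached
vertex of `B` is an outneighbour of one of these left ends, and each of them has fewer than `2k`
outneighbours in `B`. Since `80k² < q`, some vertex of `B` survives.

Exact maximum matchings are not needed: a greedy maximal matching certifies a vertex as rich or as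
poor. The machine program computes one for each vertex and each direction in `O(qn)` steps, marks
what the certified poor vertices reach, and outputs an unmarked element (`runs_pass`,
`runs_irrelevantVertexProgram`). -/

theorem Finset.card_le_mul_of_forall_exists {α E : Type*} [Fintype E] {S : Finset α}
    {p : E → α → Prop} {c : ℕ} (hS : ∀ a ∈ S, ∃ e, p e a)
    (hc : ∀ e, ∀ S' ⊆ S, (∀ a ∈ S', p e a) → S'.card ≤ c) :
    S.card ≤ Fintype.card E * c := by
  classical
  have h1 : S ⊆ Finset.univ.biUnion fun e => S.filter (p e) := by
    intro a ha
    obtain ⟨e, he⟩ := hS a ha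
    simp only [Finset.mem_biUnion, Finset.mem_univ, true_and, Finset.mem_filter]
    exact ⟨e, ha, he⟩
  refine (Finset.card_le_card h1).trans (Finset.card_biUnion_le_card_mul _ _ _ fun e _ => ?_)
  exact hc e _ (Finset.filter_subset _ _) fun a ha => (Finset.mem_filter.1 ha).2

theorem Finset.card_le_add_one_of_forall_le {α : Type*} {S : Finset α} {g : α → ℕ} (c : ℕ)
    (hg : Set.InjOn g S) (h : ∀ a ∈ S, ∀ b ∈ S, g a ≤ g b + c) : S.card ≤ c + 1 := by
  rcases S.eq_empty_or_nonempty with rfl | hne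
  · simp
  obtain ⟨b, hb, hmin⟩ := S.exists_min_image g hne
  have : S.card ≤ (Finset.Icc (g b) (g b + c)).card :=
    Finset.card_le_card_of_injOn g
      (fun a ha => by simpa using ⟨hmin a ha, h a ha b hb⟩) hg
  simp at this
  omega

/-- Used to choose a vertex, an index or a matching arc avoiding three kinds of obstruction, each of
which blocks only few candidates. -/
theorem Finset.exists_mem_not_of_card_lt {α : Type*} {S : Finset α} (p q r : α → Prop)
    {a b c : ℕ} (hp : ∀ S' ⊆ S, (∀ x ∈ S', p x) → S'.card ≤ a)
    (hq : ∀ S' ⊆ S, (∀ x ∈ S', q x) → S'.card ≤ b)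
    (hr : ∀ S' ⊆ S, (∀ x ∈ S', r x) → S'.card ≤ c) (h : a + b + c < S.card) :
    ∃ x ∈ S, ¬ p x ∧ ¬ q x ∧ ¬ r x := by
  classical
  by_contra! hcon
  have hsub : S ⊆ S.filter p ∪ S.filter q ∪ S.filter r := by
    intro x hx
    simp only [Finset.mem_union, Finset.mem_filter]
    by_cases h1 : p x
    · tauto
    · by_cases h2 : q x
      · tauto
      · have := hcon x hx h1 h2; tauto
  have h1 := hp _ (Finset.filter_subset p S) fun x hx => (Finset.mem_filter.1 hx).2
  have h2 := hq _ (Finset.filter_subset q S) fun x hx => (Finset.mem_filter.1 hx).2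
  have h3 := hr _ (Finset.filter_subset r S) fun x hx => (Finset.mem_filter.1 hx).2
  have h4 := Finset.card_le_card hsub
  have h5 := Finset.card_union_le (S.filter p ∪ S.filter q) (S.filter r)
  have h6 := Finset.card_union_le (S.filter p) (S.filter q)
  omega

end Counting

/-! ### Arc-disjoint walk systems and the consequences of minimal weight. -/

section Walks

variable {V E : Type*}

theorem traversesArc_iff {l : List V} {x y : V} :
    TraversesArc l x y ↔ ∃ i, l[i]? = some x ∧ l[i + 1]? = some y := by
  constructor
  · rintro ⟨s, t, rfl⟩
    exact ⟨s.length, by simp, by simp⟩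
  · rintro ⟨i, hi, hj⟩
    obtain ⟨h1, rfl⟩ := List.getElem?_eq_some_iff.1 hi
    obtain ⟨h2, rfl⟩ := List.getElem?_eq_some_iff.1 hj
    refine ⟨l.take i, l.drop (i + 2), ?_⟩
    conv_rhs => rw [← List.take_append_drop i l, List.drop_eq_getElem_cons h1,
      List.drop_eq_getElem_cons h2]
    simp

theorem List.IsChain.rel_of_traversesArc {R : V → V → Prop} {l : List V} (h : l.IsChain R)
    {x y : V} (hxy : TraversesArc l x y) : R x y := by
  have := h.infix hxy
  simpa using this

theorem List.IsChain.imp_of_traversesArc {R S : V → V → Prop} {l : List V} (h : l.IsChain R)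
    (hRS : ∀ x y, R x y → TraversesArc l x y → S x y) : l.IsChain S := by
  have h2 := List.isChain_isInfix l
  rw [List.isChain_iff_getElem] at *
  exact fun i hi => hRS _ _ (h i hi) (h2 i hi)

/-- A family of walks `P e` of length at least one in the digraph `R`, pairwise without common
arcs; `P e` starts in a vertex allowed by `start e` and ends in a vertex allowed by `finish e`. -/
structure IsWalkSystem (R : V → V → Prop) (start finish : E → V → Prop) (P : E → List V) :
    Prop where
  chain : ∀ e, (P e).IsChain R
  two_le : ∀ e, 2 ≤ (P e).length
  head : ∀ e, ∃ a, (P e).head? = some a ∧ start e a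
  last : ∀ e, ∃ a, (P e).getLast? = some a ∧ finish e a
  disjoint : ∀ e f, e ≠ f → ∀ x y, ¬ (TraversesArc (P e) x y ∧ TraversesArc (P f) x y)

/-- The arcs of `R` that the walk `P e` may use without meeting the other walks. -/
def FreeArc (R : V → V → Prop) (P : E → List V) (e : E) (x y : V) : Prop :=
  R x y ∧ ∀ f, f ≠ e → ¬ TraversesArc (P f) x y

/-- The length of a list where the occurrences of `x` count eleven times. -/
def walkWeight [DecidableEq V] (x : V) (l : List V) : ℕ := l.length + 10 * l.count x

section

variable [DecidableEq V]

@[simp] theorem walkWeight_append (x : V) (l l' : List V) :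
    walkWeight x (l ++ l') = walkWeight x l + walkWeight x l' := by
  simp [walkWeight]; ring

@[simp] theorem walkWeight_nil (x : V) : walkWeight x [] = 0 := by simp [walkWeight]

theorem walkWeight_cons_of_ne {x a : V} (h : a ≠ x) (l : List V) :
    walkWeight x (a :: l) = walkWeight x l + 1 := by
  simp [walkWeight, h]; ring

theorem walkWeight_cons_self (x : V) (l : List V) :
    walkWeight x (x :: l) = walkWeight x l + 11 := by
  simp [walkWeight]; ring

theorem length_le_walkWeight (x : V) (l : List V) : l.length ≤ walkWeight x l := by
  simp [walkWeight]

theorem walkWeight_of_notMem {x : V} {l : List V} (h : x ∉ l) : walkWeight x l = l.length := by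
  simp [walkWeight, List.count_eq_zero.2 h]

/-- A walk system of least total weight. -/
structure IsMinimalWalkSystem [Fintype E] (x : V) (R : V → V → Prop)
    (start finish : E → V → Prop) (P : E → List V) : Prop
    extends IsWalkSystem R start finish P where
  minimal : ∀ P', IsWalkSystem R start finish P' →
    ∑ e, walkWeight x (P e) ≤ ∑ e, walkWeight x (P' e)

theorem IsWalkSystem.exists_minimal [Fintype E] (x : V) {R : V → V → Prop}
    {start finish : E → V → Prop} {P : E → List V} (h : IsWalkSystem R start finish P) :
    ∃ P', IsMinimalWalkSystem x R start finish P' := by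
  obtain ⟨P', h', hmin⟩ := exists_minimalFor_of_wellFoundedLT
    (IsWalkSystem R start finish) (fun P => ∑ e, walkWeight x (P e)) ⟨P, h⟩
  exact ⟨P', h', fun Q hQ => (le_total _ _).elim id fun hle => hmin hQ hle⟩

end

theorem IsWalkSystem.isChain_freeArc {R : V → V → Prop} {start finish : E → V → Prop}
    {P : E → List V} (h : IsWalkSystem R start finish P) (e : E) :
    (P e).IsChain (FreeArc R P e) :=
  (h.chain e).imp_of_traversesArc fun x y hxy ht =>
    ⟨hxy, fun f hf htf => h.disjoint e f hf.symm x y ⟨ht, htf⟩⟩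

variable [DecidableEq V] [Fintype E] {x : V} {R : V → V → Prop}
  {start finish : E → V → Prop} {P : E → List V}

/-- Free arcs avoid all other walks, so replacing the single walk `P e` by `l` again gives a walk
system. Minimality of the total thus becomes minimality of each walk among walks in free arcs. -/
theorem IsMinimalWalkSystem.walkWeight_le
    (h : IsMinimalWalkSystem x R start finish P) (e : E) {l : List V}
    (hl : l.IsChain (FreeArc R P e)) (h2 : 2 ≤ l.length)
    (hhead : ∃ a, l.head? = some a ∧ start e a) (hlast : ∃ a, l.getLast? = some a ∧ finish e a) :
    walkWeight x (P e) ≤ walkWeight x l := by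
  classical
  have hsys : IsWalkSystem R start finish (Function.update P e l) := by
    have hd : ∀ f, f ≠ e → ∀ a b, ¬ (TraversesArc l a b ∧ TraversesArc (P f) a b) :=
      fun f hf a b hab => (hl.rel_of_traversesArc hab.1).2 f hf hab.2
    refine ⟨fun f => ?_, fun f => ?_, fun f => ?_, fun f => ?_, fun f g hfg a b => ?_⟩
    · by_cases hf : f = e
      · subst hf; simpa using hl.imp fun _ _ h => h.1
      · simpa [hf] using h.chain f
    · by_cases hf : f = e
      · subst hf; simpa using h2
      · simpa [hf] using h.two_le f
    · by_cases hf : f = e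
      · subst hf; simpa using hhead
      · simpa [hf] using h.head f
    · by_cases hf : f = e
      · subst hf; simpa using hlast
      · simpa [hf] using h.last f
    · by_cases hf : f = e
      · subst hf
        simpa [Ne.symm hfg] using hd g (Ne.symm hfg) a b
      · by_cases hg : g = e
        · subst hg
          have := hd f hf a b
          simp only [Function.update_self, Function.update_of_ne hf]
          tauto
        · simpa [hf, hg] using h.disjoint f g hfg a b
  have := h.minimal _ hsys
  rw [← Finset.add_sum_erase _ _ (Finset.mem_univ e),
    ← Finset.add_sum_erase _ (fun f => walkWeight x (Function.update P e l f))
      (Finset.mem_univ e)] at this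
  have h3 : ∑ f ∈ Finset.univ.erase e, walkWeight x (Function.update P e l f)
      = ∑ f ∈ Finset.univ.erase e, walkWeight x (P f) :=
    Finset.sum_congr rfl fun f hf => by rw [Function.update_of_ne (Finset.ne_of_mem_erase hf)]
  rw [h3, Function.update_self] at this
  omega

/-- Otherwise the segment between the two positions could be replaced by `mid`. As `mid` avoids `x`
its weight is its length, while the removed segment weighs at least its length. -/
theorem IsMinimalWalkSystem.index_le_of_isChain
    (h : IsMinimalWalkSystem x R start finish P) (e : E) {i j : ℕ} {a b : V} {mid : List V}
    (hi : (P e)[i]? = some a) (hj : (P e)[j]? = some b) (hij : i < j) (hx : x ∉ mid)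
    (hmid : (a :: (mid ++ [b])).IsChain (FreeArc R P e)) : j ≤ i + 1 + mid.length := by
  obtain ⟨hil, rfl⟩ := List.getElem?_eq_some_iff.1 hi
  obtain ⟨hjl, rfl⟩ := List.getElem?_eq_some_iff.1 hj
  have hc := h.isChain_freeArc e
  set l := P e with hl
  have h1 : l.take (i + 1) ++ l.drop (i + 1) = l := List.take_append_drop _ _
  have h2 : l.drop (i + 1) = (l.drop (i + 1)).take (j - (i + 1)) ++ l.drop j := by
    conv_lhs => rw [← List.take_append_drop (j - (i + 1)) (l.drop (i + 1)), List.drop_drop]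
    congr 2; omega
  have hti : l.take (i + 1) = l.take i ++ [l[i]] := by simp
  have hdj : l.drop j = l[j] :: l.drop (j + 1) := List.drop_eq_getElem_cons hjl
  have hw := h.walkWeight_le e (l := l.take (i + 1) ++ mid ++ l.drop j) ?_ ?_ ?_ ?_
  · rw [← hl] at hw
    have h3 : walkWeight x l = walkWeight x (l.take (i + 1)) +
        (walkWeight x ((l.drop (i + 1)).take (j - (i + 1))) + walkWeight x (l.drop j)) := by
      conv_lhs => rw [← h1, walkWeight_append, h2, walkWeight_append]
    have h4 := length_le_walkWeight x ((l.drop (i + 1)).take (j - (i + 1)))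
    simp only [walkWeight_append, walkWeight_of_notMem hx] at hw
    simp only [List.length_take, List.length_drop] at h4
    omega
  · have ha : (l.take i ++ [l[i]]).IsChain (FreeArc R P e) := hti ▸ hc.take (i + 1)
    have hb : (l[j] :: l.drop (j + 1)).IsChain (FreeArc R P e) := hdj ▸ hc.drop j
    rw [hti, hdj, List.append_assoc, List.append_assoc, List.singleton_append]
    refine List.isChain_split.2 ⟨ha, ?_⟩
    rw [← List.cons_append]
    exact List.isChain_split.2 ⟨by simpa using hmid, hb⟩
  · simp only [List.length_append, List.length_take, List.length_drop]; omega
  · obtain ⟨a, ha, hs⟩ := h.head e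
    refine ⟨a, ?_, hs⟩
    rw [← ha, ← hl, List.append_assoc, List.head?_append_of_ne_nil _
        (by rw [hti]; exact List.append_ne_nil_of_right_ne_nil _ (List.cons_ne_nil _ _)),
      List.head?_take]
    simp
  · obtain ⟨a, ha, hs⟩ := h.last e
    refine ⟨a, ?_, hs⟩
    rw [← ha, ← hl, List.getLast?_append_of_ne_nil _ (by rw [hdj]; exact List.cons_ne_nil _ _), List.getLast?_drop]
    simp [hjl]

/-- A walk of a minimal system repeats no vertex, except that its ends may agree. -/
theorem IsMinimalWalkSystem.index_eq
    (h : IsMinimalWalkSystem x R start finish P) (e : E) {i j : ℕ} {a : V}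
    (hi : (P e)[i]? = some a) (hj : (P e)[j]? = some a) (hij : i < j) :
    i = 0 ∧ j + 1 = (P e).length := by
  obtain ⟨hil, rfl⟩ := List.getElem?_eq_some_iff.1 hi
  obtain ⟨hjl, hji⟩ := List.getElem?_eq_some_iff.1 hj
  by_contra hcon
  have hc := h.isChain_freeArc e
  set l := P e with hl
  have h2 : l.drop i = (l.drop i).take (j - i) ++ l.drop j := by
    conv_lhs => rw [← List.take_append_drop (j - i) (l.drop i), List.drop_drop]
    congr 2; omega
  have hti : l.take (i + 1) = l.take i ++ [l[i]] := by simp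
  have hdj : l.drop j = l[i] :: l.drop (j + 1) := hji ▸ List.drop_eq_getElem_cons hjl
  -- Cutting out the closed segment lowers the weight. The result is still admissible because two
  -- vertices remain, which fails exactly when the repeated vertex is both the first and the last
  -- one.
  have hw := h.walkWeight_le e (l := l.take i ++ l.drop j) ?_ ?_ ?_ ?_
  · rw [← hl] at hw
    have h3 : walkWeight x l = walkWeight x (l.take i) +
        (walkWeight x ((l.drop i).take (j - i)) + walkWeight x (l.drop j)) := by
      conv_lhs => rw [← List.take_append_drop i l, walkWeight_append, h2, walkWeight_append]
    have h4 := length_le_walkWeight x ((l.drop i).take (j - i))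
    simp only [walkWeight_append] at hw
    simp only [List.length_take, List.length_drop] at h4
    omega
  · have ha : (l.take i ++ [l[i]]).IsChain (FreeArc R P e) := hti ▸ hc.take (i + 1)
    have hb : (l[i] :: l.drop (j + 1)).IsChain (FreeArc R P e) := hdj ▸ hc.drop j
    rw [hdj]
    exact List.isChain_split.2 ⟨ha, hb⟩
  · simp only [List.length_append, List.length_take, List.length_drop]; omega
  · obtain ⟨a, ha, hs⟩ := h.head e
    refine ⟨a, ?_, hs⟩
    rw [← ha, ← hl]
    have : (l.take i ++ l.drop j).head? = (l.take (i + 1)).head? := by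
      rw [hti, hdj]; cases l.take i <;> simp
    rw [this, List.head?_take]; simp
  · obtain ⟨a, ha, hs⟩ := h.last e
    refine ⟨a, ?_, hs⟩
    rw [← ha, ← hl, List.getLast?_append_of_ne_nil _ (by rw [hdj]; exact List.cons_ne_nil _ _), List.getLast?_drop]
    simp [hjl]

/-- Each walk leaves `y` at most once: a repeated vertex occurs only at both ends, and the final
occurrence has no successor. -/
theorem IsMinimalWalkSystem.card_out_le (h : IsMinimalWalkSystem x R start finish P) (y : V)
    {S : Finset V} (hS : ∀ w ∈ S, ∃ f, TraversesArc (P f) y w) : S.card ≤ Fintype.card E := by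
  have := Finset.card_le_mul_of_forall_exists (c := 1) hS fun e S' _ h' => ?_
  · simpa using this
  rw [Finset.card_le_one]
  intro w hw w' hw'
  obtain ⟨i, hi, hi'⟩ := traversesArc_iff.1 (h' w hw)
  obtain ⟨j, hj, hj'⟩ := traversesArc_iff.1 (h' w' hw')
  have hil := (List.getElem?_eq_some_iff.1 hi').1
  have hjl := (List.getElem?_eq_some_iff.1 hj').1
  rcases lt_trichotomy i j with hij | rfl | hij
  · have := h.index_eq e hi hj hij; omega
  · exact Option.some.inj (hi'.symm.trans hj')
  · have := h.index_eq e hj hi hij; omega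

/-- Each walk enters `y` at most once, since the initial occurrence of a repeated vertex has no
predecessor. -/
theorem IsMinimalWalkSystem.card_in_le (h : IsMinimalWalkSystem x R start finish P) (y : V)
    {S : Finset V} (hS : ∀ w ∈ S, ∃ f, TraversesArc (P f) w y) : S.card ≤ Fintype.card E := by
  have := Finset.card_le_mul_of_forall_exists (c := 1) hS fun e S' _ h' => ?_
  · simpa using this
  rw [Finset.card_le_one]
  intro w hw w' hw'
  obtain ⟨i, hi, hi'⟩ := traversesArc_iff.1 (h' w hw)
  obtain ⟨j, hj, hj'⟩ := traversesArc_iff.1 (h' w' hw')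
  rcases lt_trichotomy i j with hij | rfl | hij
  · have := h.index_eq e hi' hj' (by omega); omega
  · exact Option.some.inj (hi.symm.trans hj)
  · have := h.index_eq e hj' hi' (by omega); omega

end Walks

/-! ### Vertices with many or few short walks to `B`. -/

section Rich

variable {V : Type*}

/-- A set `Mt` of pairwise disjoint arcs `(w, b)` of `R` from vertices with `Y` to vertices
in `B`. -/
structure IsMatchingInto (R : V → V → Prop) (Y : V → Prop) (B : Finset V)
    (Mt : Finset (V × V)) : Prop where
  left : ∀ p ∈ Mt, Y p.1
  right : ∀ p ∈ Mt, p.2 ∈ B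
  rel : ∀ p ∈ Mt, R p.1 p.2
  injOn_fst : Set.InjOn Prod.fst (Mt : Set (V × V))
  injOn_snd : Set.InjOn Prod.snd (Mt : Set (V × V))

/-- A matching that cannot be extended by another arc. -/
structure IsMaximalMatchingInto (R : V → V → Prop) (Y : V → Prop) (B : Finset V)
    (Mt : Finset (V × V)) : Prop extends IsMatchingInto R Y B Mt where
  maximal : ∀ w b, Y w → b ∈ B → R w b → ∃ p ∈ Mt, p.1 = w ∨ p.2 = b

/-- There are many short walks from `y` to `B`. -/
def IsRich (R : V → V → Prop) (B : Finset V) (k : ℕ) (y : V) : Prop :=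
  (∃ S ⊆ B, (∀ b ∈ S, R y b) ∧ 2 * k ≤ S.card) ∨
    ∃ Mt, IsMatchingInto R (R y) B Mt ∧ 5 * k ≤ Mt.card

/-- Certificate that there are few short walks from `y` to `B`. -/
def IsPoor (R : V → V → Prop) (B : Finset V) (k : ℕ) (y : V) : Prop :=
  (∀ S ⊆ B, (∀ b ∈ S, R y b) → S.card < 2 * k) ∧
    ∃ Mt, IsMaximalMatchingInto R (R y) B Mt ∧ Mt.card < 5 * k

/-- With `s` walks, at most `s` outgoing arcs of `y` are used and at most `4s` vertices of `B` are
entered. The vertex `x` spoils one direct arc, or at most two matching arcs, one at either end. The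
thresholds `2k` and `5k` exceed `s + 1` and `s + 4s + 2`. -/
theorem IsRich.exists_route {R used : V → V → Prop} {B : Finset V} {k s : ℕ} {y : V}
    (h : IsRich R B k y) (x : V) (hk : s + 1 ≤ k) (hs : 1 ≤ s)
    (hout : ∀ S : Finset V, (∀ w ∈ S, used y w) → S.card ≤ s)
    (hB : ∀ S ⊆ B, (∀ b ∈ S, ∃ w, used w b) → S.card ≤ s * 4) :
    ∃ b ∈ B, b ≠ x ∧ ((R y b ∧ ¬ used y b) ∨
      ∃ w, w ≠ x ∧ R y w ∧ ¬ used y w ∧ R w b ∧ ¬ used w b) := by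
  classical
  rcases h with ⟨S, hSB, hS, hc⟩ | ⟨Mt, hMt, hc⟩
  · obtain ⟨b, hb, h1, h2, -⟩ := S.exists_mem_not_of_card_lt (fun b => used y b) (fun b => b = x)
      (fun _ => False) (a := s) (b := 1) (c := 0) (fun S' _ h' => hout S' h')
      (fun S' _ h' => Finset.card_le_one.2 fun a ha b hb => (h' a ha).trans (h' b hb).symm)
      (fun S' _ h' => by simpa using Finset.eq_empty_of_forall_notMem h') (by omega)
    exact ⟨b, hSB hb, h2, Or.inl ⟨hS b hb, h1⟩⟩
  · have hA : ∀ S' ⊆ Mt, (∀ p ∈ S', used y p.1) → S'.card ≤ s := fun S' hS' h' => by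
      rw [← Finset.card_image_of_injOn (hMt.injOn_fst.mono (Finset.coe_subset.2 hS'))]
      exact hout _ (by simpa using fun a b hab => h' (a, b) hab)
    have hC : ∀ S' ⊆ Mt, (∀ p ∈ S', ∃ w, used w p.2) → S'.card ≤ s * 4 := fun S' hS' h' => by
      rw [← Finset.card_image_of_injOn (hMt.injOn_snd.mono (Finset.coe_subset.2 hS'))]
      refine hB _ ?_ (by simpa using fun b a hab => h' (a, b) hab)
      intro b hb
      obtain ⟨p, hp, rfl⟩ := Finset.mem_image.1 hb
      exact hMt.right p (hS' hp)
    have hD : ∀ S' ⊆ Mt, (∀ p ∈ S', p.1 = x ∨ p.2 = x) → S'.card ≤ 2 := fun S' hS' h' => by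
      have hsub : S' ⊆ S'.filter (fun p => p.1 = x) ∪ S'.filter (fun p => p.2 = x) := by
        intro p hp
        simpa [hp] using h' p hp
      have h4 : (S'.filter (fun p => p.1 = x)).card ≤ 1 := Finset.card_le_one.2 fun a ha b hb =>
        hMt.injOn_fst (hS' (Finset.mem_filter.1 ha).1) (hS' (Finset.mem_filter.1 hb).1)
          ((Finset.mem_filter.1 ha).2.trans (Finset.mem_filter.1 hb).2.symm)
      have h5 : (S'.filter (fun p => p.2 = x)).card ≤ 1 := Finset.card_le_one.2 fun a ha b hb =>
        hMt.injOn_snd (hS' (Finset.mem_filter.1 ha).1) (hS' (Finset.mem_filter.1 hb).1)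
          ((Finset.mem_filter.1 ha).2.trans (Finset.mem_filter.1 hb).2.symm)
      have := (Finset.card_le_card hsub).trans (Finset.card_union_le _ _)
      omega
    obtain ⟨p, hp, h1, h2, h3⟩ := Mt.exists_mem_not_of_card_lt (fun p => used y p.1)
      (fun p => ∃ w, used w p.2) (fun p => p.1 = x ∨ p.2 = x) hA hC hD (by omega)
    push Not at h2 h3
    exact ⟨p.2, hMt.right p hp, h3.2,
      Or.inr ⟨p.1, h3.1, hMt.left p hp, h1, hMt.rel p hp, h2 _⟩⟩

theorem exists_isMaximalMatchingInto [Finite V] (R : V → V → Prop) (Y : V → Prop)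
    (B : Finset V) : ∃ Mt, IsMaximalMatchingInto R Y B Mt := by
  classical
  obtain ⟨Mt, hMt⟩ := (Set.toFinite {Mt | IsMatchingInto R Y B Mt}).exists_maximal
    ⟨∅, by constructor <;> simp⟩
  refine ⟨Mt, hMt.1, fun w b hw hb hwb => ?_⟩
  by_contra! hcon
  have hnot : (w, b) ∉ Mt := fun h => (hcon _ h).1 rfl
  have hins : IsMatchingInto R Y B (insert (w, b) Mt) := by
    obtain ⟨⟨h1, h2, h3, h4, h5⟩, -⟩ := hMt
    refine ⟨?_, ?_, ?_, ?_, ?_⟩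
    · simpa [hw] using h1
    · simpa [hb] using h2
    · simpa [hwb] using h3
    · rw [Finset.coe_insert, Set.injOn_insert (by simpa using hnot)]
      refine ⟨h4, ?_⟩
      rintro ⟨p, hp, hpw⟩
      exact (hcon p hp).1 hpw
    · rw [Finset.coe_insert, Set.injOn_insert (by simpa using hnot)]
      refine ⟨h5, ?_⟩
      rintro ⟨p, hp, hpw⟩
      exact (hcon p hp).2 hpw
  exact hnot (hMt.2 hins (Finset.subset_insert _ _) (Finset.mem_insert_self _ _))

/-- A semicomplete digraph on a set `S` has a vertex of large outdegree. -/
theorem card_le_of_outdegree_le {α : Type*} (S : Finset α) (R : α → α → Prop) {d : ℕ}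
    (hR : ∀ a ∈ S, ∀ b ∈ S, a ≠ b → R a b ∨ R b a)
    (hd : ∀ a ∈ S, ∀ S' ⊆ S, (∀ b ∈ S', R a b) → S'.card ≤ d) : S.card ≤ 2 * d + 1 := by
  classical
  rcases Nat.eq_zero_or_pos S.card with h0 | h0
  · omega
  have h1 : S.offDiag ⊆ (S ×ˢ S).filter (fun p => R p.1 p.2) ∪
      (S ×ˢ S).filter (fun p => R p.2 p.1) := by
    rintro ⟨a, b⟩ h
    rw [Finset.mem_offDiag] at h
    have := hR a h.1 b h.2.1 h.2.2
    simp only [Finset.mem_union, Finset.mem_filter, Finset.mem_product]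
    tauto
  have h2 : ((S ×ˢ S).filter (fun p => R p.1 p.2)).card ≤ S.card * d := by
    rw [Finset.card_filter, Finset.sum_product, ← smul_eq_mul]
    refine Finset.sum_le_card_nsmul _ _ _ fun a ha => ?_
    rw [← Finset.card_filter]
    exact hd a ha _ (Finset.filter_subset _ _) fun b hb => (Finset.mem_filter.1 hb).2
  have h3 : ((S ×ˢ S).filter (fun p => R p.2 p.1)).card ≤ S.card * d := by
    rw [Finset.card_filter, Finset.sum_product_right, ← smul_eq_mul]
    refine Finset.sum_le_card_nsmul _ _ _ fun a ha => ?_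
    rw [← Finset.card_filter]
    exact hd a ha _ (Finset.filter_subset _ _) fun b hb => (Finset.mem_filter.1 hb).2
  have h4 := (Finset.card_le_card h1).trans (Finset.card_union_le _ _)
  rw [Finset.offDiag_card] at h4
  have h5 : S.card * S.card ≤ S.card * (2 * d + 1) := by
    have : S.card * (2 * d + 1) = S.card * d + S.card * d + S.card := by ring
    omega
  exact Nat.le_of_mul_le_mul_left h5 h0

/-- The left ends of a maximal matching from poor vertices into `B` form a semicomplete digraph of
small outdegree, so there are at most `20k` of them, each with fewer than `2k` outneighbours in `B`.
-/
theorem card_reached_by_poor_le [Finite V] {R : V → V → Prop}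
    (hR : ∀ x y, x ≠ y → R x y ∨ R y x) {B S : Finset V} {k : ℕ} (hSB : S ⊆ B)
    (hS : ∀ b ∈ S, ∃ y, IsPoor R B k y ∧ R y b) : S.card ≤ 40 * k ^ 2 := by
  classical
  obtain ⟨Mt, hMt⟩ := exists_isMaximalMatchingInto R (IsPoor R B k) B
  -- The poor vertex `p.1` has its own maximal matching `G` with at most `5k - 1` arcs. Every arc of
  -- `Mt` starting in an outneighbour of `p.1` meets `G`, at most `|G|` of them on the left and at
  -- most `|G|` on the right, so the outdegree is at most `2(5k - 1)`.
  have hm : Mt.card ≤ 2 * (2 * (5 * k - 1)) + 1 := by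
    refine card_le_of_outdegree_le Mt (fun p p' => R p.1 p'.1)
      (fun p hp p' hp' hne => hR _ _ fun h => hne (hMt.injOn_fst hp hp' h)) ?_
    intro p hp S' hS' hout
    obtain ⟨-, G, hG, hGc⟩ := hMt.left p hp
    have hsub : S' ⊆ S'.filter (fun p' => ∃ g ∈ G, g.1 = p'.1) ∪
        S'.filter (fun p' => ∃ g ∈ G, g.2 = p'.2) := by
      intro p' hp'
      obtain ⟨g, hg, h⟩ := hG.maximal p'.1 p'.2 (hout p' hp') (hMt.right _ (hS' hp'))
        (hMt.rel _ (hS' hp'))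
      simp only [Finset.mem_union, Finset.mem_filter, hp', true_and]
      rcases h with h | h
      · exact Or.inl ⟨g, hg, h⟩
      · exact Or.inr ⟨g, hg, h⟩
    have h1 : (S'.filter (fun p' => ∃ g ∈ G, g.1 = p'.1)).card ≤ G.card := by
      refine (Finset.card_le_card_of_injOn Prod.fst (t := G.image Prod.fst) ?_ ?_).trans
        Finset.card_image_le
      · intro p' hp'
        obtain ⟨g, hg, h⟩ := (Finset.mem_filter.1 hp').2
        exact Finset.mem_image.2 ⟨g, hg, h⟩
      · exact hMt.injOn_fst.mono fun p' hp' => hS' (Finset.mem_filter.1 hp').1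
    have h2 : (S'.filter (fun p' => ∃ g ∈ G, g.2 = p'.2)).card ≤ G.card := by
      refine (Finset.card_le_card_of_injOn Prod.snd (t := G.image Prod.snd) ?_ ?_).trans
        Finset.card_image_le
      · intro p' hp'
        obtain ⟨g, hg, h⟩ := (Finset.mem_filter.1 hp').2
        exact Finset.mem_image.2 ⟨g, hg, h⟩
      · exact hMt.injOn_snd.mono fun p' hp' => hS' (Finset.mem_filter.1 hp').1
    have := (Finset.card_le_card hsub).trans (Finset.card_union_le _ _)
    omega
  -- By maximality an arc `(y, b)` from a poor vertex shares `y` or `b` with an arc of `Mt`. In both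
  -- cases `b` is an outneighbour of a left end.
  have hsub : S ⊆ Mt.biUnion fun p => B.filter fun b => R p.1 b := by
    intro b hb
    obtain ⟨y, hy, hyb⟩ := hS b hb
    obtain ⟨p, hp, h⟩ := hMt.maximal y b hy (hSB hb) hyb
    simp only [Finset.mem_biUnion, Finset.mem_filter]
    refine ⟨p, hp, hSB hb, ?_⟩
    rcases h with rfl | rfl
    · exact hyb
    · exact hMt.rel p hp
  have hcard := (Finset.card_le_card hsub).trans
    (Finset.card_biUnion_le_card_mul _ _ (2 * k) fun p hp =>
      ((hMt.left p hp).1 _ (Finset.filter_subset _ _)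
        fun b hb => (Finset.mem_filter.1 hb).2).le)
  rcases Nat.eq_zero_or_pos k with rfl | hk
  · omega
  · calc S.card ≤ Mt.card * (2 * k) := hcard
      _ ≤ (20 * k) * (2 * k) := Nat.mul_le_mul_right _ (by omega)
      _ = 40 * k ^ 2 := by ring

end Rich

/-! ### Rerouting walks through the triple. -/

section Rerouting

variable {V E : Type*}

/-- The sets of a triple around its middle set `B`: complete from `a` to `B` and from `B` to `c`,
with return arcs from `c j` to `a j`. -/
structure IsTripleAround (R : V → V → Prop) (B : Finset V) (q : ℕ) (a c : Fin q → V) :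
    Prop where
  card_eq : B.card = q
  left_injective : Function.Injective a
  right_injective : Function.Injective c
  left_notMem : ∀ j, a j ∉ B
  right_notMem : ∀ j, c j ∉ B
  left_rel : ∀ j, ∀ b ∈ B, R (a j) b
  rel_right : ∀ j, ∀ b ∈ B, R b (c j)
  right_rel_left : ∀ j, R (c j) (a j)

theorem FreeArc.of_not {R : V → V → Prop} {P : E → List V} {e : E} {v w : V} (h : R v w)
    (hn : ¬ ∃ f, TraversesArc (P f) v w) : FreeArc R P e v w :=
  ⟨h, fun f _ hf => hn ⟨f, hf⟩⟩

variable [DecidableEq V] [Fintype E] {x : V} {R : V → V → Prop} {start finish : E → V → Prop}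
  {P : E → List V} {B : Finset V} {q : ℕ} {a c : Fin q → V}

/-- If a walk uses the arc from `c j` to `a j` and much later the one from `c j'` to `a j'`, then `a
j → b → c j'` is a shortcut for some free `b ≠ x`. The positions of the `c j` on one walk therefore
differ by at most three. -/
theorem IsMinimalWalkSystem.card_return_le (h : IsMinimalWalkSystem x R start finish P)
    (ht : IsTripleAround R B q a c) (hq : 2 * Fintype.card E + 1 < q) {S : Finset (Fin q)}
    (hS : ∀ j ∈ S, ∃ f, TraversesArc (P f) (c j) (a j)) : S.card ≤ Fintype.card E * 4 := by
  refine Finset.card_le_mul_of_forall_exists hS fun e S' _ h' => ?_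
  simp only [traversesArc_iff] at h'
  have : ∀ j : Fin q, ∃ i, j ∈ S' → (P e)[i]? = some (c j) ∧ (P e)[i + 1]? = some (a j) :=
    fun j => by
      by_cases hj : j ∈ S'
      · obtain ⟨i, hi⟩ := h' j hj; exact ⟨i, fun _ => hi⟩
      · exact ⟨0, fun hj' => absurd hj' hj⟩
  choose g hg using this
  refine Finset.card_le_add_one_of_forall_le (g := g) 3 ?_ ?_
  · intro j hj j' hj' hjj
    have h1 := (hg j hj).1
    have h2 := (hg j' hj').1
    rw [hjj, h2] at h1
    exact (ht.right_injective (Option.some.inj h1)).symm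
  · intro j' hj' j hj
    by_contra! hlt
    obtain ⟨b, hb, hb1, hb2, hbx⟩ := B.exists_mem_not_of_card_lt
      (fun b => ∃ f, TraversesArc (P f) (a j) b) (fun b => ∃ f, TraversesArc (P f) b (c j'))
      (fun b => b = x) (a := Fintype.card E) (b := Fintype.card E) (c := 1)
      (fun S' _ h' => h.card_out_le _ h') (fun S' _ h' => h.card_in_le _ h')
      (fun S' _ h' => Finset.card_le_one.2 fun a ha b hb => (h' a ha).trans (h' b hb).symm)
      (by rw [ht.card_eq]; omega)
    have := h.index_le_of_isChain e (hg j hj).2 (hg j' hj').1 (mid := [b]) (by omega)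
      (by simpa using Ne.symm hbx)
      (by
        simp only [List.singleton_append, List.isChain_cons_cons, List.isChain_singleton,
          and_true]
        exact ⟨.of_not (ht.left_rel j b hb) hb1, .of_not (ht.rel_right j' b hb) hb2⟩)
    simp at this
    omega

/-- An index `j` is blocked by its arc from `b`, its return arc, or its arc to `b'`. With `s` walks
this excludes at most `s + 4s + s` indices. -/
theorem IsMinimalWalkSystem.exists_connection (h : IsMinimalWalkSystem x R start finish P)
    (ht : IsTripleAround R B q a c) (hq : 6 * Fintype.card E + 1 < q) (e : E) {b b' : V}
    (hb : b ∈ B) (hb' : b' ∈ B) :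
    ∃ j, FreeArc R P e b (c j) ∧ FreeArc R P e (c j) (a j) ∧ FreeArc R P e (a j) b' := by
  classical
  have h1 : ∀ S' : Finset (Fin q), (∀ j ∈ S', ∃ f, TraversesArc (P f) b (c j)) →
      S'.card ≤ Fintype.card E := fun S' h' => by
    rw [← Finset.card_image_of_injective S' ht.right_injective]
    exact h.card_out_le b (by simpa using h')
  have h2 : ∀ S' : Finset (Fin q), (∀ j ∈ S', ∃ f, TraversesArc (P f) (a j) b') →
      S'.card ≤ Fintype.card E := fun S' h' => by
    rw [← Finset.card_image_of_injective S' ht.left_injective]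
    exact h.card_in_le b' (by simpa using h')
  obtain ⟨w, -, h1, h2, h3⟩ := (Finset.univ : Finset (Fin q)).exists_mem_not_of_card_lt _ _ _
    (fun S' _ => h1 S') (fun S' _ => h.card_return_le ht (by omega) (S := S'))
    (fun S' _ => h2 S') (by simp; omega)
  exact ⟨w, .of_not (ht.rel_right w b hb) h1, .of_not (ht.right_rel_left w) h2,
    .of_not (ht.left_rel w b' hb') h3⟩

/-- Two vertices of `B` on a walk are joined by a free segment with the two inner vertices `c j` and
`a j`, both distinct from `x`. Their positions thus differ by at most three, leaving at most four
vertices of `B` per walk. -/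
theorem IsMinimalWalkSystem.card_visited_le (h : IsMinimalWalkSystem x R start finish P)
    (ht : IsTripleAround R B q a c) (hx : x ∈ B) (hq : 6 * Fintype.card E + 1 < q)
    {S : Finset V} (hSB : S ⊆ B) (hS : ∀ b ∈ S, ∃ f, b ∈ P f) :
    S.card ≤ Fintype.card E * 4 := by
  refine Finset.card_le_mul_of_forall_exists hS fun e S' hS' h' => ?_
  have hidx : ∀ b ∈ S', (P e)[(P e).idxOf b]? = some b := fun b hb => by
    rw [List.getElem?_eq_getElem (List.idxOf_lt_length_of_mem (h' b hb))]
    simp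
  refine Finset.card_le_add_one_of_forall_le (g := fun b => (P e).idxOf b) 3 ?_ ?_
  · intro b hb b' hb' hbb
    have h1 := hidx b hb
    rw [show (P e).idxOf b = (P e).idxOf b' from hbb, hidx b' hb'] at h1
    exact (Option.some.inj h1).symm
  · intro b' hb' b hb
    by_contra! hlt
    obtain ⟨j, h1, h2, h3⟩ := h.exists_connection ht hq e (hSB (hS' hb)) (hSB (hS' hb'))
    have hne : x ≠ c j ∧ x ≠ a j := ⟨fun h => ht.right_notMem j (h ▸ hx),
      fun h => ht.left_notMem j (h ▸ hx)⟩
    have := h.index_le_of_isChain e (hidx b hb) (hidx b' hb') (mid := [c j, a j]) (by omega)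
      (by simpa using hne) (by simp [h1, h2, h3])
    simp at this
    omega

/-- Supplies `IsRich.exists_route` with the bounds valid in a minimal system; the route found is
unused by all walks. -/
theorem IsMinimalWalkSystem.exists_route_out (h : IsMinimalWalkSystem x R start finish P)
    (ht : IsTripleAround R B q a c) (hx : x ∈ B) (hq : 6 * Fintype.card E + 1 < q) {k : ℕ}
    (hk : Fintype.card E + 1 ≤ k) (e : E) {y : V} (hy : IsRich R B k y) :
    ∃ l b, b ∈ B ∧ b ≠ x ∧ x ∉ l ∧ l.length ≤ 1 ∧
      (y :: (l ++ [b])).IsChain (FreeArc R P e) := by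
  obtain ⟨b, hb, hbx, h1⟩ := hy.exists_route (used := fun v w => ∃ f, TraversesArc (P f) v w)
    x hk (Fintype.card_pos_iff.2 ⟨e⟩) (fun S hS => h.card_out_le y hS)
    (fun S hSB hS => h.card_visited_le ht hx hq hSB fun b hb => by
      obtain ⟨w, f, hf⟩ := hS b hb
      exact ⟨f, hf.subset (by simp)⟩)
  rcases h1 with ⟨h1, h2⟩ | ⟨w, hw, h1, h2, h3, h4⟩
  · exact ⟨[], b, hb, hbx, by simp, by simp, by simp [FreeArc.of_not (e := e) h1 h2]⟩
  · exact ⟨[w], b, hb, hbx, by simpa using hw.symm, by simp,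
      by simp [FreeArc.of_not (e := e) h1 h2, FreeArc.of_not (e := e) h3 h4]⟩

theorem IsMinimalWalkSystem.exists_route_in (h : IsMinimalWalkSystem x R start finish P)
    (ht : IsTripleAround R B q a c) (hx : x ∈ B) (hq : 6 * Fintype.card E + 1 < q) {k : ℕ}
    (hk : Fintype.card E + 1 ≤ k) (e : E) {z : V} (hz : IsRich (flip R) B k z) :
    ∃ l b, b ∈ B ∧ b ≠ x ∧ x ∉ l ∧ l.length ≤ 1 ∧
      (b :: (l ++ [z])).IsChain (FreeArc R P e) := by
  obtain ⟨b, hb, hbx, h1⟩ := hz.exists_route (used := fun v w => ∃ f, TraversesArc (P f) w v)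
    x hk (Fintype.card_pos_iff.2 ⟨e⟩) (fun S hS => h.card_in_le z hS)
    (fun S hSB hS => h.card_visited_le ht hx hq hSB fun b hb => by
      obtain ⟨w, f, hf⟩ := hS b hb
      exact ⟨f, hf.subset (by simp)⟩)
  rcases h1 with ⟨h1, h2⟩ | ⟨w, hw, h1, h2, h3, h4⟩
  · exact ⟨[], b, hb, hbx, by simp, by simp, by simp [FreeArc.of_not (R := R) (e := e) h1 h2]⟩
  · exact ⟨[w], b, hb, hbx, by simpa using hw.symm, by simp,
      by simp [FreeArc.of_not (R := R) (e := e) h1 h2,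
        FreeArc.of_not (R := R) (e := e) h3 h4]⟩

/-- In a minimal walk system the vertex `x` is not used, if its neighbours on the walks have many
short walks to and from the triple, and if `x` as an end of a walk may be replaced by `x'`. -/
theorem IsMinimalWalkSystem.notMem (h : IsMinimalWalkSystem x R start finish P)
    (ht : IsTripleAround R B q a c) (hx : x ∈ B) (hq : 6 * Fintype.card E + 1 < q) {k : ℕ}
    (hk : Fintype.card E + 1 ≤ k) (hout : ∀ y, R y x → IsRich R B k y)
    (hin : ∀ z, R x z → IsRich (flip R) B k z) {x' : V} (hx' : x' ∈ B) (hne : x' ≠ x)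
    (hstart : ∀ e, start e x → start e x') (hfinish : ∀ e, finish e x → finish e x') (e : E) :
    x ∉ P e := by
  intro hmem
  obtain ⟨l₁, l₂, hl⟩ := List.append_of_mem hmem
  have hc := h.isChain_freeArc e
  rw [hl] at hc
  obtain ⟨hc₁, hc₂⟩ := List.isChain_split.1 hc
  -- The part before `x` is redirected to end in `B` at additional weight at most two: an optional
  -- intermediate vertex and `b`. If `x` starts the walk, the new start is `x'`. The part after `x`
  -- is treated symmetrically.
  have hleft : ∃ L b, b ∈ B ∧ (L ++ [b]).IsChain (FreeArc R P e) ∧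
      walkWeight x (L ++ [b]) ≤ walkWeight x l₁ + 2 ∧
      ∃ v, (L ++ [b]).head? = some v ∧ start e v := by
    obtain ⟨v, hv, hsv⟩ := h.head e
    rw [hl] at hv
    rcases l₁.eq_nil_or_concat' with rfl | ⟨m, y, rfl⟩
    · obtain rfl : x = v := by simpa using hv
      exact ⟨[], x', hx', by simp, by simp [walkWeight_cons_of_ne hne], x', by simp,
        hstart e hsv⟩
    · rw [List.append_assoc, List.singleton_append] at hc₁
      obtain ⟨h1, h2⟩ := List.isChain_split.1 hc₁
      have hyx : R y x := by simpa [FreeArc] using (List.isChain_pair.1 h2).1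
      obtain ⟨l, b, hb, hbx, hxl, hlen, hlc⟩ := h.exists_route_out ht hx hq hk e (hout y hyx)
      refine ⟨m ++ y :: l, b, hb, ?_, ?_, v, ?_, hsv⟩
      · rw [List.append_assoc, List.cons_append]
        exact List.isChain_split.2 ⟨h1, hlc⟩
      · rw [List.append_cons m y l]
        rw [walkWeight_append, walkWeight_append, walkWeight_of_notMem hxl,
          walkWeight_cons_of_ne hbx, walkWeight_nil]
        omega
      · rw [← hv]; cases m <;> simp
  have hright : ∃ L b, b ∈ B ∧ (b :: L).IsChain (FreeArc R P e) ∧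
      walkWeight x (b :: L) ≤ walkWeight x l₂ + 2 ∧
      ∃ v, (b :: L).getLast? = some v ∧ finish e v := by
    obtain ⟨v, hv, hsv⟩ := h.last e
    rw [hl] at hv
    rcases l₂ with _ | ⟨z, m⟩
    · obtain rfl : x = v := by simpa using hv
      exact ⟨[], x', hx', by simp, by simp [walkWeight_cons_of_ne hne], x', by simp,
        hfinish e hsv⟩
    · have hxz : R x z := (List.isChain_cons_cons.1 hc₂).1.1
      have h2 := (List.isChain_cons_cons.1 hc₂).2
      obtain ⟨l, b, hb, hbx, hxl, hlen, hlc⟩ := h.exists_route_in ht hx hq hk e (hin z hxz)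
      refine ⟨l ++ z :: m, b, hb, ?_, ?_, v, ?_, hsv⟩
      · rw [← List.cons_append]
        exact List.isChain_split.2 ⟨hlc, h2⟩
      · rw [walkWeight_cons_of_ne hbx, walkWeight_append, walkWeight_of_notMem hxl]
        omega
      · rw [← hv, ← List.cons_append, List.getLast?_append_of_ne_nil _ (by simp),
          List.getLast?_append_of_ne_nil _ (by simp), List.getLast?_cons_cons]
  obtain ⟨L, b, hb, hLc, hLw, hLs⟩ := hleft
  obtain ⟨L', b', hb', hLc', hLw', hLs'⟩ := hright
  obtain ⟨j, h1, h2, h3⟩ := h.exists_connection ht hq e hb hb'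
  have hcx : c j ≠ x := fun h => ht.right_notMem j (h ▸ hx)
  have hax : a j ≠ x := fun h => ht.left_notMem j (h ▸ hx)
  -- The two redirected parts add at most two each, and `c j` and `a j` add two more. The total of
  -- six is less than the eleven saved at `x`. The new walk may repeat vertices or arcs of its own.
  have hw := h.walkWeight_le e (l := (L ++ [b]) ++ (c j :: a j :: b' :: L')) ?_ ?_ ?_ ?_
  · rw [hl, walkWeight_append, walkWeight_append, walkWeight_cons_self, walkWeight_cons_of_ne hcx,
      walkWeight_cons_of_ne hax] at hw
    omega
  · rw [List.append_assoc, List.singleton_append]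
    refine List.isChain_split.2 ⟨hLc, ?_⟩
    simp only [List.isChain_cons_cons, h1, h2, h3, true_and]
    exact hLc'
  · simp; omega
  · obtain ⟨v, hv, hsv⟩ := hLs
    exact ⟨v, by rw [← hv, List.head?_append_of_ne_nil _ (by simp)], hsv⟩
  · obtain ⟨v, hv, hsv⟩ := hLs'
    exact ⟨v, by rw [← hv, List.getLast?_append_of_ne_nil _ (by simp), List.getLast?_cons_cons,
      List.getLast?_cons_cons], hsv⟩

end Rerouting

/-! ### From walk systems to immersions, and irrelevance of `x`. -/

section Immersions

variable {V E U : Type*}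

/-- Every walk contains a path between its ends. -/
theorem exists_nodup_of_walk (l : List V) :
    ∃ p : List V, p.Nodup ∧ p ⊆ l ∧ p.head? = l.head? ∧ p.getLast? = l.getLast? ∧
      ∀ y z, TraversesArc p y z → TraversesArc l y z := by
  induction hn : l.length using Nat.strong_induction_on generalizing l with
  | _ n ih =>
    rcases l with _ | ⟨a, m⟩
    · exact ⟨[], by simp⟩
    by_cases ha : a ∈ m
    · obtain ⟨s, t, rfl⟩ := List.append_of_mem ha
      obtain ⟨p, h1, h2, h3, h4, h5⟩ := ih (a :: t).length
        (by simp only [List.length_cons, List.length_append] at hn ⊢; omega) (a :: t) rfl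
      have hsuf : a :: t <:+ a :: (s ++ a :: t) := ⟨a :: s, by simp⟩
      refine ⟨p, h1, List.Subset.trans h2 hsuf.subset, by simpa using h3, ?_, fun y z h =>
        (h5 y z h).trans hsuf.isInfix⟩
      rw [h4, ← List.cons_append, List.getLast?_append_of_ne_nil _ (by simp)]
    · rcases m with _ | ⟨b, m⟩
      · exact ⟨[a], by simp⟩
      obtain ⟨p, h1, h2, h3, h4, h5⟩ := ih (b :: m).length (by simp at hn ⊢; omega) (b :: m) rfl
      rcases p with _ | ⟨b', p⟩
      · simp at h3
      obtain rfl : b' = b := by simpa using h3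
      refine ⟨a :: b' :: p, List.nodup_cons.2 ⟨fun h => ha (h2 h), h1⟩,
        List.cons_subset_cons a h2, by simp, ?_, fun y z h => ?_⟩
      · rw [List.getLast?_cons_cons, h4, List.getLast?_cons_cons]
      · rcases List.infix_cons_iff.1 h with h | h
        · obtain ⟨rfl, h'⟩ := List.cons_prefix_cons.1 h
          obtain ⟨rfl, -⟩ := List.cons_prefix_cons.1 h'
          exact ⟨[], m, by simp⟩
        · exact (h5 y z h).trans (List.suffix_cons _ _).isInfix

theorem List.IsChain.of_traversesArc_subset {R : V → V → Prop} {l p : List V} (h : l.IsChain R)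
    (hp : ∀ y z, TraversesArc p y z → TraversesArc l y z) : p.IsChain R :=
  (List.isChain_isInfix p).imp fun y z hyz => h.rel_of_traversesArc (hp y z hyz)

theorem exists_isDirectedPath (T : Digraph V) {l : List V} (h : l.IsChain T.Adj) {x y : V}
    (hx : l.head? = some x) (hy : l.getLast? = some y) :
    ∃ p, T.IsDirectedPath x y p ∧ ∀ y z, TraversesArc p y z → TraversesArc l y z := by
  obtain ⟨p, h1, -, h3, h4, h5⟩ := exists_nodup_of_walk l
  exact ⟨p, ⟨h.of_traversesArc_subset h5, h1, h3.trans hx, h4.trans hy⟩, h5⟩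

/-- The walk without its first vertex is shortened to a path, and the first vertex is then put back
in front. -/
theorem exists_isDirectedCycleThrough (T : Digraph V) {l : List V} (h : l.IsChain T.Adj) {x : V}
    (hx : l.head? = some x) (hy : l.getLast? = some x) (h2 : 2 ≤ l.length) :
    ∃ p, T.IsDirectedCycleThrough x p ∧ ∀ y z, TraversesArc p y z → TraversesArc l y z := by
  rcases l with _ | ⟨x', _ | ⟨b, m⟩⟩
  · simp at h2
  · simp at h2
  obtain rfl : x' = x := by simpa using hx
  obtain ⟨p, h1, -, h3, h4, h5⟩ := exists_nodup_of_walk (b :: m)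
  rcases p with _ | ⟨b', p⟩
  · simp at h3
  obtain rfl : b' = b := by simpa using h3
  have harc : ∀ y z, TraversesArc (x' :: b' :: p) y z → TraversesArc (x' :: b' :: m) y z := by
    intro y z h
    rcases List.infix_cons_iff.1 h with h | h
    · obtain ⟨rfl, h'⟩ := List.cons_prefix_cons.1 h
      obtain ⟨rfl, -⟩ := List.cons_prefix_cons.1 h'
      exact ⟨[], m, by simp⟩
    · exact (h5 y z h).trans (List.suffix_cons _ _).isInfix
  refine ⟨x' :: b' :: p, ⟨h.of_traversesArc_subset harc, by simp, by simpa using h1, by simp, ?_⟩,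
    harc⟩
  rw [List.getLast?_cons_cons] at hy ⊢
  exact h4.trans hy

theorem traversesArc_map {W : Type*} {f : V → W} {l : List V}
    {y z : W} : TraversesArc (l.map f) y z ↔ ∃ a b, f a = y ∧ f b = z ∧ TraversesArc l a b := by
  simp only [traversesArc_iff, List.getElem?_map, Option.map_eq_some_iff]
  constructor
  · rintro ⟨i, ⟨a, ha, rfl⟩, b, hb, rfl⟩
    exact ⟨a, b, rfl, rfl, i, ha, hb⟩
  · rintro ⟨a, b, rfl, rfl, i, ha, hb⟩
    exact ⟨i, ⟨a, ha, rfl⟩, b, hb, rfl⟩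

theorem HasRootedImmersion.of_deleteVertex {t : ℕ} {H : MultiDigraph U E} {u : Fin t → U}
    {T : Digraph V} {v : Fin t → V} {x : V} (hx : ∀ i, v i ≠ x)
    (h : HasRootedImmersion H u (T.deleteVertex x) (fun i => ⟨v i, hx i⟩)) :
    HasRootedImmersion H u T v := by
  obtain ⟨φ, P, ⟨hφ, hpath, hcycle, hdisj⟩, hroot⟩ := h
  refine ⟨fun w => (φ w).1, fun e => (P e).map Subtype.val, ⟨Subtype.val_injective.comp hφ,
    fun e he => ?_, fun e he => ?_, fun e f hef y z => ?_⟩, fun i =>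
      congrArg Subtype.val (hroot i)⟩
  · obtain ⟨h1, h2, h3, h4⟩ := hpath e he
    exact ⟨(List.isChain_map _).2 h1, h2.map Subtype.val_injective, by rw [List.head?_map, h3]; rfl,
      by rw [List.getLast?_map, h4]; rfl⟩
  · obtain ⟨h1, h2, h3, h4, h5⟩ := hcycle e he
    refine ⟨(List.isChain_map _).2 h1, by simpa using h2, ?_, by rw [List.head?_map, h4]; rfl,
      by rw [List.getLast?_map, h5]; rfl⟩
    rw [← List.map_tail]
    exact h3.map Subtype.val_injective
  · simp only [traversesArc_map]
    rintro ⟨⟨a, b, rfl, rfl, h1⟩, a', b', h2, h3, h4⟩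
    rw [Subtype.val_injective h2, Subtype.val_injective h3] at h4
    exact hdisj e f hef a b ⟨h1, h4⟩

theorem List.two_le_length_of_head?_ne_getLast? {l : List V} {a b : V} (ha : l.head? = some a)
    (hb : l.getLast? = some b) (hab : a ≠ b) : 2 ≤ l.length := by
  rcases l with _ | ⟨y, _ | ⟨z, m⟩⟩
  · simp at ha
  · simp at ha hb
    exact absurd (ha.symm.trans hb) hab
  · simp

theorem IsImmersion.isWalkSystem {H : MultiDigraph U E} {T : Digraph V} {φ : U → V}
    {P : E → List V} (h : IsImmersion H T φ P) :
    IsWalkSystem T.Adj (fun e a => a = φ (H.src e)) (fun e a => a = φ (H.tgt e)) P := by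
  obtain ⟨hφ, hpath, hcycle, hdisj⟩ := h
  refine ⟨fun e => ?_, fun e => ?_, fun e => ?_, fun e => ?_, hdisj⟩ <;>
    by_cases he : H.src e = H.tgt e
  · exact (hcycle e he).1
  · exact (hpath e he).1
  · exact (hcycle e he).2.1
  · exact List.two_le_length_of_head?_ne_getLast? (hpath e he).2.2.1 (hpath e he).2.2.2
      fun h => he (hφ h)
  · exact ⟨_, (hcycle e he).2.2.2.1, rfl⟩
  · exact ⟨_, (hpath e he).2.2.1, rfl⟩
  · exact ⟨_, (hcycle e he).2.2.2.2, by rw [he]⟩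
  · exact ⟨_, (hpath e he).2.2.2, rfl⟩

theorem IsWalkSystem.mono {R : V → V → Prop} {start finish start' finish' : E → V → Prop}
    {P : E → List V} (h : IsWalkSystem R start finish P) (hs : ∀ e a, start e a → start' e a)
    (hf : ∀ e a, finish e a → finish' e a) : IsWalkSystem R start' finish' P :=
  ⟨h.chain, h.two_le, fun e => (h.head e).imp fun a ha => ⟨ha.1, hs e a ha.2⟩,
    fun e => (h.last e).imp fun a ha => ⟨ha.1, hf e a ha.2⟩, h.disjoint⟩

/-- Each walk is shortened to a path or cycle using only arcs of that walk, so disjointness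
persists. -/
theorem IsWalkSystem.exists_isImmersion {H : MultiDigraph U E} {T : Digraph V} {φ : U → V}
    {P : E → List V} (hφ : Function.Injective φ)
    (h : IsWalkSystem T.Adj (fun e a => a = φ (H.src e)) (fun e a => a = φ (H.tgt e)) P) :
    ∃ P', IsImmersion H T φ P' := by
  have key : ∀ e, ∃ p, (H.src e ≠ H.tgt e → T.IsDirectedPath (φ (H.src e)) (φ (H.tgt e)) p) ∧
      (H.src e = H.tgt e → T.IsDirectedCycleThrough (φ (H.src e)) p) ∧
      ∀ y z, TraversesArc p y z → TraversesArc (P e) y z := by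
    intro e
    obtain ⟨a, ha, rfl⟩ := h.head e
    obtain ⟨b, hb, rfl⟩ := h.last e
    by_cases he : H.src e = H.tgt e
    · obtain ⟨p, hp, hp'⟩ := exists_isDirectedCycleThrough T (h.chain e) ha (he ▸ hb) (h.two_le e)
      exact ⟨p, fun hne => absurd he hne, fun _ => hp, hp'⟩
    · obtain ⟨p, hp, hp'⟩ := exists_isDirectedPath T (h.chain e) ha hb
      exact ⟨p, fun _ => hp, fun he' => absurd he' he, hp'⟩
  choose Q h1 h2 h3 using key
  exact ⟨Q, hφ, h1, h2, fun e f hef y z hyz =>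
    h.disjoint e f hef y z ⟨h3 e y z hyz.1, h3 f y z hyz.2⟩⟩

/-- A vertex `x` of the middle set of a large triple is irrelevant if there are many short walks
from its inneighbours to the middle set and from the middle set to its outneighbours. -/
theorem hasRootedImmersion_deleteVertex_iff [Fintype U] [Fintype E] [DecidableEq V] {t k q : ℕ}
    {H : MultiDigraph U E} {u : Fin t → U} {T : Digraph V} {v : Fin t → V} {B : Finset V}
    {a c : Fin q → V} (ht : IsTripleAround T.Adj B q a c) {x : V}
    (hxB : x ∈ B) (hx : ∀ i, v i ≠ x) (hq : 6 * Fintype.card E + 1 < q)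
    (hqU : Fintype.card U + 1 < q) (hk : Fintype.card U + Fintype.card E ≤ k)
    (hout : ∀ y, T.Adj y x → IsRich T.Adj B k y)
    (hin : ∀ z, T.Adj x z → IsRich (flip T.Adj) B k z) :
    HasRootedImmersion H u T v ↔
      HasRootedImmersion H u (T.deleteVertex x) (fun i => ⟨v i, hx i⟩) := by
  refine ⟨?_, .of_deleteVertex hx⟩
  rintro ⟨φ, P, hP, hroot⟩
  have hφ := hP.1
  obtain ⟨x', hx'B, hx'⟩ : ∃ x' ∈ B, x' ∉ insert x (Finset.univ.image φ) := by
    apply Finset.exists_mem_notMem_of_card_lt_card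
    rw [ht.card_eq]
    have h1 := Finset.card_insert_le x (Finset.univ.image φ)
    have h2 : (Finset.univ.image φ).card ≤ Fintype.card U := Finset.card_image_le
    omega
  simp only [Finset.mem_insert, Finset.mem_image, Finset.mem_univ, true_and, not_or,
    not_exists] at hx'
  -- At most one vertex of `H` is moved, to a vertex of `B` outside the image of `φ`. Roots stay in
  -- place, as no root is mapped to `x`.
  set ψ : U → V := fun w => if φ w = x then x' else φ w with hψdef
  have hψx : ∀ w, ψ w ≠ x := fun w => by
    by_cases hw : φ w = x
    · simpa [hψdef, hw] using hx'.1
    · simp [hψdef, hw]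
  have hψ : Function.Injective ψ := fun w w' hww => by
    by_cases hw : φ w = x <;> by_cases hw' : φ w' = x <;> simp only [hψdef, hw, hw'] at hww
    · exact hφ (hw.trans hw'.symm)
    · exact absurd (by simpa using hww.symm) (hx'.2 w')
    · exact absurd (by simpa using hww) (hx'.2 w)
    · exact hφ (by simpa using hww)
  -- Both old and new ends are allowed, so that the given immersion counts as a competitor. Once `x`
  -- is known to be unused, every end is the one prescribed by `ψ`.
  obtain ⟨Q, hQ⟩ := (hP.isWalkSystem.mono
    (start' := fun e a => a = φ (H.src e) ∨ a = ψ (H.src e))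
    (finish' := fun e a => a = φ (H.tgt e) ∨ a = ψ (H.tgt e))
    (fun e a h => Or.inl h) (fun e a h => Or.inl h)).exists_minimal x
  have hnot : ∀ e, x ∉ Q e := fun e => by
    -- The existence of an arc forces a vertex, whence `|E| + 1 ≤ k`, as the routes require.
    have hE : 1 ≤ Fintype.card U := Fintype.card_pos_iff.2 ⟨H.src e⟩
    refine hQ.notMem ht hxB hq (by omega) hout hin hx'B hx'.1 (fun f hf => ?_)
      (fun f hf => ?_) e
    · have hf := hf.resolve_right (hψx _).symm
      simp [hψdef, ← hf]
    · have hf := hf.resolve_right (hψx _).symm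
      simp [hψdef, ← hf]
  have hval : ∀ w, φ w ≠ x → ψ w = φ w := fun w hw => by simp [hψdef, hw]
  have key : ∀ e, ∃ l : List {y : V // y ≠ x}, l.map Subtype.val = Q e := fun e =>
    ⟨(Q e).attachWith _ fun y hy (h : y = x) => hnot e (h ▸ hy), by simp⟩
  choose S hS using key
  have hsys : IsWalkSystem (T.deleteVertex x).Adj
      (fun e a => a = (⟨ψ (H.src e), hψx _⟩ : {y : V // y ≠ x}))
      (fun e a => a = (⟨ψ (H.tgt e), hψx _⟩ : {y : V // y ≠ x})) S := by
    refine ⟨fun e => ?_, fun e => ?_, fun e => ?_, fun e => ?_, fun e f hef y z hyz => ?_⟩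
    · have := hQ.chain e
      rw [← hS, List.isChain_map] at this
      exact this
    · have := hQ.two_le e
      rwa [← hS, List.length_map] at this
    · obtain ⟨a, ha, h⟩ := hQ.head e
      have hax : a ≠ x := fun h => hnot e (h ▸ List.mem_of_head? ha)
      rw [← hS, List.head?_map, Option.map_eq_some_iff] at ha
      obtain ⟨b, hb, rfl⟩ := ha
      refine ⟨b, hb, Subtype.ext ?_⟩
      rcases h with h | h
      · exact h.trans (hval _ (h ▸ hax)).symm
      · exact h
    · obtain ⟨a, ha, h⟩ := hQ.last e
      have hax : a ≠ x := fun h => hnot e (h ▸ List.mem_of_getLast? ha)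
      rw [← hS, List.getLast?_map, Option.map_eq_some_iff] at ha
      obtain ⟨b, hb, rfl⟩ := ha
      refine ⟨b, hb, Subtype.ext ?_⟩
      rcases h with h | h
      · exact h.trans (hval _ (h ▸ hax)).symm
      · exact h
    · refine hQ.disjoint e f hef y z ?_
      rw [← hS, ← hS, traversesArc_map,
        traversesArc_map]
      exact ⟨⟨y, z, rfl, rfl, hyz.1⟩, y, z, rfl, rfl, hyz.2⟩
  obtain ⟨P', hP'⟩ := hsys.exists_isImmersion
    (φ := fun w => (⟨ψ w, hψx w⟩ : {y : V // y ≠ x})) fun w w' h => hψ (congrArg Subtype.val h)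
  refine ⟨_, P', hP', fun i => Subtype.ext ?_⟩
  change ψ (u i) = v i
  rw [hval _ (by rw [hroot]; exact hx i), hroot]

/-- Few vertices of `B` are outneighbours of vertices with few short walks to `B`, or inneighbours
of vertices with few short walks from `B`. -/
theorem card_reached_by_poor_le_both [Finite V] {T : Digraph V} (hT : T.IsSemicomplete)
    {B S : Finset V} {k : ℕ} (hSB : S ⊆ B)
    (hS : ∀ b ∈ S, (∃ y, IsPoor T.Adj B k y ∧ T.Adj y b) ∨
      ∃ y, IsPoor (flip T.Adj) B k y ∧ flip T.Adj y b) : S.card ≤ 80 * k ^ 2 := by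
  classical
  have h1 := card_reached_by_poor_le (R := T.Adj) hT.2 (B := B) (k := k)
    (S := S.filter fun b => ∃ y, IsPoor T.Adj B k y ∧ T.Adj y b)
    ((Finset.filter_subset _ _).trans hSB) (fun b hb => (Finset.mem_filter.1 hb).2)
  have h2 := card_reached_by_poor_le (R := flip T.Adj) (fun x y h => (hT.2 x y h).symm)
    (B := B) (k := k) (S := S.filter fun b => ∃ y, IsPoor (flip T.Adj) B k y ∧ flip T.Adj y b)
    ((Finset.filter_subset _ _).trans hSB) (fun b hb => (Finset.mem_filter.1 hb).2)
  have hsub : S ⊆ (S.filter fun b => ∃ y, IsPoor T.Adj B k y ∧ T.Adj y b) ∪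
      S.filter fun b => ∃ y, IsPoor (flip T.Adj) B k y ∧ flip T.Adj y b := by
    intro b hb
    have := hS b hb
    simp only [Finset.mem_union, Finset.mem_filter]
    exact this.imp (⟨hb, ·⟩) (⟨hb, ·⟩)
  have := (Finset.card_le_card hsub).trans (Finset.card_union_le _ _)
  omega

end Immersions

/-! ### Rules for deriving halting, running time and results of programs. -/

section Machine

/-- Started with memory `M`, the program halts within `t` steps with a memory satisfying `Q`. -/
def Runs (I : List (List ℕ)) (W : ℕ) (P : RAMProgram) (M : ℕ → ℕ) (t : ℕ)
    (Q : (ℕ → ℕ) → Prop) : Prop :=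
  ∃ τ M', RAMExec I W P M τ M' ∧ τ ≤ t ∧ Q M'

variable {I : List (List ℕ)} {W : ℕ} {M : ℕ → ℕ} {P P' : RAMProgram} {Q Q' : (ℕ → ℕ) → Prop}
  {t t' t'' r s s' a : ℕ}

theorem Runs.mono (h : Runs I W P M t Q) (ht : t ≤ t') (hQ : ∀ M', Q M' → Q' M') :
    Runs I W P M t' Q' := by
  obtain ⟨τ, M', h1, h2, h3⟩ := h
  exact ⟨τ, M', h1, h2.trans ht, hQ M' h3⟩

theorem Runs.skip (h : Q M) : Runs I W .skip M 1 Q := ⟨1, M, .skip M, le_rfl, h⟩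

theorem Runs.const (hW : a < W) (h : Q (Function.update M r a)) :
    Runs I W (.const r a) M 1 Q := ⟨1, _, .const M r a hW, le_rfl, h⟩

theorem Runs.add (hW : M s + M s' < W) (h : Q (Function.update M r (M s + M s'))) :
    Runs I W (.add r s s') M 1 Q := ⟨1, _, .add M r s s' hW, le_rfl, h⟩

theorem Runs.sub (hW : M s - M s' < W) (h : Q (Function.update M r (M s - M s'))) :
    Runs I W (.sub r s s') M 1 Q := ⟨1, _, .sub M r s s' hW, le_rfl, h⟩

theorem Runs.load (hW : M (M s) < W) (h : Q (Function.update M r (M (M s)))) :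
    Runs I W (.load r s) M 1 Q := ⟨1, _, .load M r s hW, le_rfl, h⟩

theorem Runs.store (hW : M s < W) (h : Q (Function.update M (M r) (M s))) :
    Runs I W (.store r s) M 1 Q := ⟨1, _, .store M r s hW, le_rfl, h⟩

theorem Runs.read (v : ℕ) (hv : (I.getD (M s) []).getD (M s') 0 = v) (hW : v < W)
    (h : Q (Function.update M r v)) : Runs I W (.read r s s') M 1 Q := by
  subst hv
  exact ⟨1, _, .read M r s s' hW, le_rfl, h⟩

theorem Runs.seq (h : Runs I W P M t fun M' => Runs I W P' M' t' Q) (ht : t + t' ≤ t'') :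
    Runs I W (.seq P P') M t'' Q := by
  obtain ⟨τ, M', h1, h2, τ', M'', h3, h4, h5⟩ := h
  exact ⟨τ + τ', M'', .seq h1 h3, by omega, h5⟩

/-- Sequencing after an elementary instruction. -/
theorem Runs.cons (h : Runs I W P M 1 fun M' => Runs I W P' M' t Q) :
    Runs I W (.seq P P') M (t + 1) Q := h.seq (by omega)

theorem Runs.ite (h1 : M r ≠ 0 → Runs I W P M t Q) (h2 : M r = 0 → Runs I W P' M t Q) :
    Runs I W (.ite r P P') M (t + 1) Q := by
  by_cases hr : M r = 0
  · obtain ⟨τ, M', h3, h4, h5⟩ := h2 hr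
    exact ⟨1 + τ, M', .iteFalse hr h3, by omega, h5⟩
  · obtain ⟨τ, M', h3, h4, h5⟩ := h1 hr
    exact ⟨1 + τ, M', .iteTrue hr h3, by omega, h5⟩

/-- `for M r := M N - 1, …, 0 do P`; the cells `1` and `31` have to hold one and zero. -/
def RAMProgram.forDown (r N : ℕ) (P : RAMProgram) : RAMProgram :=
  .seq (.add r N 31) (.loop r (.seq (.sub r r 1) P))

/-- `Inv j` is the state after the rounds with counter values `j` and above. Each round costs the
test, the decrement and the body; the final `1` is the failing test. -/
theorem Runs.loop_forDown (Inv : ℕ → (ℕ → ℕ) → Prop) {m : ℕ} (hm : m < W)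
    (step : ∀ j < m, ∀ M, M r = j + 1 → Inv (j + 1) M →
      M 1 = 1 ∧ Runs I W P (Function.update M r j) t fun M' => M' r = j ∧ Inv j M')
    {j : ℕ} (hj : j ≤ m) (hr : M r = j) (hM : Inv j M) :
    Runs I W (.loop r (.seq (.sub r r 1) P)) M (1 + j * (t + 2)) (Inv 0) := by
  induction j generalizing M with
  | zero => exact ⟨1, M, .loopFalse hr, by omega, hM⟩
  | succ j ih =>
    obtain ⟨h1, τ, M', h3, h4, h5, h6⟩ := step j (by omega) M hr hM
    obtain ⟨τ', M'', h7, h8, h9⟩ := ih (by omega) h5 h6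
    have hsub := RAMExec.sub (I := I) (W := W) M r r 1 (by omega)
    rw [show M r - M 1 = j by omega] at hsub
    refine ⟨1 + (1 + τ) + τ', M'', .loopTrue (by omega) (.seq hsub h3) h7, ?_, h9⟩
    have : (j + 1) * (t + 2) = j * (t + 2) + (t + 2) := by ring
    omega

theorem Runs.forDown (Inv : ℕ → (ℕ → ℕ) → Prop) {N m : ℕ} (hN : M N = m) (hm : m < W)
    (h31 : M 31 = 0) (init : Inv m (Function.update M r m))
    (step : ∀ j < m, ∀ M, M r = j + 1 → Inv (j + 1) M →
      M 1 = 1 ∧ Runs I W P (Function.update M r j) t fun M' => M' r = j ∧ Inv j M')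
    (final : ∀ M', Inv 0 M' → Q M') :
    Runs I W (.forDown r N P) M (2 + m * (t + 2)) Q := by
  refine Runs.seq (t := 1) (t' := 1 + m * (t + 2)) (Runs.add (by omega) ?_) (by omega)
  have : Function.update M r (M N + M 31) = Function.update M r m := by rw [hN, h31, add_zero]
  rw [this]
  exact (Runs.loop_forDown Inv hm step le_rfl (by simp) init).mono le_rfl final

end Machine

/-! ### The program and its verification. -/

section Program

/-- `M r := 1` if the arc `(M a, M b)` is present, `M r := 0` otherwise. -/
def readArc (r a b : ℕ) : RAMProgram := .seq (.add 16 7 a) (.read r 16 b)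

/-- `M r := 1` if the arc `(M b, M a)` is present, `M r := 0` otherwise. -/
def readArcRev (r a b : ℕ) : RAMProgram := .seq (.add 16 7 b) (.read r 16 a)

/-- `M 11 := M 11 +` the number of elements of `B` reached by an arc from `M 8`. -/
def countProgram (arc : ℕ → ℕ → ℕ → RAMProgram) : RAMProgram :=
  .forDown 10 3 (.seq (.read 14 6 10) (.seq (arc 15 8 14) (.add 11 11 15)))

/-- Unmark all elements of `B` as matched. -/
def resetProgram : RAMProgram := .forDown 10 3 (.seq (.add 16 19 10) (.store 16 31))

/-- If there is an arc from `M 9` to an unmatched element of `B`, then let `M 13` be its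
position plus one. -/
def searchProgram (arc : ℕ → ℕ → ℕ → RAMProgram) : RAMProgram :=
  .forDown 10 3 (.seq (.read 14 6 10) (.seq (arc 15 9 14) (.ite 15
    (.seq (.add 16 19 10) (.seq (.load 17 16) (.ite 17 .skip (.add 13 10 1)))) .skip)))

/-- Greedily match vertices reached by an arc from `M 8` to elements of `B`; `M 12` counts the
matched pairs. -/
def matchProgram (arc : ℕ → ℕ → ℕ → RAMProgram) : RAMProgram :=
  .forDown 9 2 (.seq (arc 15 8 9) (.ite 15
    (.seq (.const 13 0) (.seq (searchProgram arc)
      (.ite 13 (.seq (.sub 13 13 1) (.seq (.add 16 19 13) (.seq (.store 16 1) (.add 12 12 1))))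
        .skip))) .skip))

/-- Mark all elements of `B` reached by an arc from `M 8` as forbidden. -/
def markProgram (arc : ℕ → ℕ → ℕ → RAMProgram) : RAMProgram :=
  .forDown 10 3 (.seq (.read 14 6 10) (.seq (arc 15 8 14) (.ite 15
    (.seq (.add 16 18 10) (.store 16 1)) .skip)))

/-- Mark the elements of `B` reached by an arc from a vertex with few short walks to `B`. -/
def passProgram (arc : ℕ → ℕ → ℕ → RAMProgram) : RAMProgram :=
  .forDown 8 2 (.seq (.const 11 0) (.seq (.const 12 0) (.seq (countProgram arc)
    (.seq resetProgram (.seq (matchProgram arc) (.seq (.sub 15 4 11) (.ite 15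
      (.seq (.sub 15 5 12) (.ite 15 (markProgram arc) .skip)) .skip)))))))

/-- Set the constants and the parameters read from the input. -/
def initProgram : RAMProgram :=
  .seq (.const 1 1) (.seq (.const 7 8) (.seq (.const 6 2) (.seq (.const 18 32)
    (.seq (.read 2 31 31) (.seq (.read 14 31 1) (.seq (.const 15 2) (.seq (.read 15 31 15)
      (.seq (.const 16 4) (.seq (.read 3 31 16) (.seq (.add 14 14 15) (.seq (.add 4 14 14)
        (.seq (.add 5 4 4) (.seq (.add 5 5 14) (.add 19 18 2))))))))))))))

/-- Output an unmarked element of `B`. -/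
def outputProgram : RAMProgram :=
  .forDown 10 3 (.seq (.add 16 18 10) (.seq (.load 17 16) (.ite 17 .skip (.read 0 6 10))))

/-- Cell 0 is the output; cells 1 to 7, 18, 19 and 31 are constants; 8, 9, 10 are loop counters; 11
and 12 hold the number of arcs into `B` and the matching size; 13 to 17 are scratch. Forbidden marks
start at cell 32 and matched marks at `32 + n`, both indexed by positions in the list of `B`; the
blocks are disjoint because `q ≤ n`. The second pass adds to the forbidden marks of the first. -/
def irrelevantVertexProgram : RAMProgram :=
  .seq initProgram (.seq (passProgram readArc) (.seq (passProgram readArcRev) outputProgram))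

/-- The constant cells. -/
structure HasConstants (n q k : ℕ) (M : ℕ → ℕ) : Prop where
  one : M 1 = 1
  card : M 2 = n
  size : M 3 = q
  two_mul : M 4 = 2 * k
  five_mul : M 5 = 5 * k
  row : M 6 = 2
  offset : M 7 = 8
  base : M 18 = 32
  base' : M 19 = 32 + n
  zero : M 31 = 0

theorem HasConstants.congr {n q k : ℕ} {M M' : ℕ → ℕ} (h : HasConstants n q k M)
    (hM : ∀ a ∈ [1, 2, 3, 4, 5, 6, 7, 18, 19, 31], M' a = M a) : HasConstants n q k M' := by
  obtain ⟨h1, h2, h3, h4, h5, h6, h7, h8, h9, h10⟩ := h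
  simp only [List.forall_mem_cons] at hM
  constructor <;> simp [*]

/-- The program `arc r a b` decides the relation `R` between the vertices in the cells `a` and
`b`. -/
def DecidesArc (I : List (List ℕ)) (W : ℕ) {n : ℕ} (R : Fin n → Fin n → Prop)
    (arc : ℕ → ℕ → ℕ → RAMProgram) : Prop :=
  ∀ (M : ℕ → ℕ) (Q : (ℕ → ℕ) → Prop) (r a b : ℕ) (x y : Fin n), M 7 = 8 → M a = x → M b = y →
    a ≠ 16 → b ≠ 16 →
    (∀ z e, (e = 1 ∧ R x y ∨ e = 0 ∧ ¬ R x y) →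
      Q (Function.update (Function.update M 16 z) r e)) →
    Runs I W (arc r a b) M 2 Q

variable {I : List (List ℕ)} {W n q k : ℕ} {M : ℕ → ℕ} {R : Fin n → Fin n → Prop}
  {arc : ℕ → ℕ → ℕ → RAMProgram} {β : Fin q → Fin n} {B : Finset (Fin n)}

theorem decidesArc_readArc (hW : 8 + n < W) (hI : ∀ x y : Fin n,
    (I.getD (8 + x) []).getD y 0 = 1 ∧ R x y ∨ (I.getD (8 + x) []).getD y 0 = 0 ∧ ¬ R x y) :
    DecidesArc I W R readArc := by
  intro M Q r a b x y h7 ha hb ha16 hb16 hQ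
  refine Runs.seq (t := 1) (t' := 1) (Runs.add (by omega) ?_) le_rfl
  refine Runs.read _ rfl ?_ ?_
  · simp only [Function.update_self, Function.update_of_ne hb16, h7, ha, hb]
    rcases hI x y with h | h <;> omega
  · simp only [Function.update_self, Function.update_of_ne hb16, h7, ha, hb]
    exact hQ _ _ (hI x y)

theorem decidesArc_readArcRev (hW : 8 + n < W) (hI : ∀ x y : Fin n,
    (I.getD (8 + x) []).getD y 0 = 1 ∧ R x y ∨ (I.getD (8 + x) []).getD y 0 = 0 ∧ ¬ R x y) :
    DecidesArc I W (flip R) readArcRev := by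
  intro M Q r a b x y h7 ha hb ha16 hb16 hQ
  exact decidesArc_readArc hW hI M Q r b a y x h7 hb ha hb16 ha16 hQ

theorem runs_count (hW : 5 * n + 100 ≤ W) (hqn : q ≤ n)
    (hI : ∀ i : Fin q, (I.getD 2 []).getD i 0 = β i) (harc : DecidesArc I W R arc)
    (hc : HasConstants n q k M) {y : Fin n} (hy : M 8 = y) (h11 : M 11 = 0) :
    Runs I W (countProgram arc) M (2 + q * 6) fun M' =>
      (∀ a, a ∉ [10, 11, 14, 15, 16] → M' a = M a) ∧
      ∃ S : Finset (Fin q), (∀ i, i ∈ S ↔ R y (β i)) ∧ M' 11 = S.card := by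
  refine Runs.forDown (t := 4) (m := q) (fun j M' => (∀ a, a ∉ [10, 11, 14, 15, 16] → M' a = M a) ∧
      ∃ S : Finset (Fin q), (∀ i, i ∈ S ↔ j ≤ i ∧ R y (β i)) ∧ M' 11 = S.card) hc.size (by omega)
      hc.zero ?_ ?_ ?_
  · exact ⟨fun a ha => by simp at ha; simp [ha], ∅, fun i => by simp, by simp [h11]⟩
  · rintro j hj M₁ hr ⟨hM₁, S, hS, h11'⟩
    have hc₁ : HasConstants n q k M₁ := hc.congr fun a ha => hM₁ a (by revert a; decide)
    refine ⟨hc₁.one, Runs.cons (t := 3) (Runs.read (β ⟨j, hj⟩) ?_ (by omega) ?_)⟩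
    · simpa [hc₁.row] using hI ⟨j, hj⟩
    have h8 : M₁ 8 = y := by rw [hM₁ 8 (by decide), hy]
    refine Runs.seq (t := 2) (t' := 1) ?_ le_rfl
    refine harc _ _ _ _ _ y (β ⟨j, hj⟩) (by simp [hc₁.offset]) (by simp [h8]) (by simp)
      (by decide) (by decide) ?_
    intro z e he
    have hcard : S.card ≤ q := by simpa using S.card_le_univ
    refine Runs.add ?_ ?_
    · simp [h11']; omega
    refine ⟨by simp, fun a ha => ?_, ?_⟩
    · have := hM₁ a ha
      simp at ha
      simp [ha, this]
    · have hnot : (⟨j, hj⟩ : Fin q) ∉ S := fun h => by have := ((hS _).1 h).1; simp at this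
      rcases he with ⟨rfl, he⟩ | ⟨rfl, he⟩
      · refine ⟨insert ⟨j, hj⟩ S, fun i => ?_, by simp [h11', hnot]⟩
        rw [Finset.mem_insert, hS, Fin.ext_iff]
        constructor
        · rintro (h | h)
          · obtain rfl : i = ⟨j, hj⟩ := Fin.ext h
            exact ⟨le_rfl, he⟩
          · exact ⟨by omega, h.2⟩
        · rintro ⟨h1, h2⟩
          rcases h1.eq_or_lt with h | h
          · exact Or.inl h.symm
          · exact Or.inr ⟨h, h2⟩
      · refine ⟨S, fun i => ?_, by simp [h11']⟩
        rw [hS]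
        constructor
        · exact fun h => ⟨by omega, h.2⟩
        · rintro ⟨h1, h2⟩
          rcases h1.eq_or_lt with h | h
          · obtain rfl : i = ⟨j, hj⟩ := Fin.ext h.symm
            exact absurd h2 he
          · exact ⟨h, h2⟩
  · rintro M' ⟨h1, S, h2, h3⟩
    exact ⟨h1, S, by simpa using h2, h3⟩

theorem runs_reset (hW : 5 * n + 100 ≤ W) (hqn : q ≤ n) (hc : HasConstants n q k M) :
    Runs I W resetProgram M (2 + q * 4) fun M' =>
      (∀ a, a ∉ [10, 16] → a < 32 + n → M' a = M a) ∧ ∀ i < q, M' (32 + n + i) = 0 := by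
  refine Runs.forDown (t := 2) (m := q) (fun j M' =>
      (∀ a, a ∉ [10, 16] → a < 32 + n → M' a = M a) ∧ ∀ i < q, j ≤ i → M' (32 + n + i) = 0)
      hc.size (by omega) hc.zero ?_ ?_ ?_
  · exact ⟨fun a ha _ => by simp at ha; simp [ha], fun i hi hqi => by omega⟩
  · rintro j hj M₁ hr ⟨hM₁, hU⟩
    have hc₁ : HasConstants n q k M₁ := hc.congr fun a ha => hM₁ a (by revert a; decide)
      (by have : ∀ a ∈ [1, 2, 3, 4, 5, 6, 7, 18, 19, 31], a < 32 := by decide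
          have := this a ha; omega)
    refine ⟨hc₁.one, Runs.cons (t := 1) (Runs.add ?_ (Runs.store ?_ ?_))⟩
    · simp [hc₁.base']; omega
    · simp [hc₁.zero]; omega
    · have h19 := hc₁.base'
      have h31 := hc₁.zero
      simp only [Function.update_apply, h19, h31]
      refine ⟨?_, fun a ha han => ?_, fun i hi hji => ?_⟩
      · simp; omega
      · have := hM₁ a ha han
        simp at ha
        simp [ha, this]
        omega
      · by_cases hij : i = j
        · simp [hij]
        · have := hU i hi (by omega)
          rw [← this]
          simp [hij]
          simp (disch := omega) only [if_neg]
  · exact fun M' h => ⟨h.1, fun i hi => h.2 i hi (by omega)⟩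

theorem HasConstants.congr_of_lt {M M' : ℕ → ℕ} (h : HasConstants n q k M)
    (hM : ∀ a ∈ [1, 2, 3, 4, 5, 6, 7, 18, 19, 31], a < 32 → M' a = M a) :
    HasConstants n q k M' := by
  refine h.congr fun a ha => hM a ha ?_
  revert a
  decide

/-- The scan does not stop at a hit; later hits overwrite earlier ones. Storing the position plus
one reserves zero for failure. -/
theorem runs_search (hW : 5 * n + 100 ≤ W) (hqn : q ≤ n)
    (hI : ∀ i : Fin q, (I.getD 2 []).getD i 0 = β i) (harc : DecidesArc I W R arc)
    (hc : HasConstants n q k M) {w : Fin n} (hw : M 9 = w) (h13 : M 13 = 0)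
    (hU : ∀ i < q, M (32 + n + i) ≤ 1) :
    Runs I W (searchProgram arc) M (2 + q * 10) fun M' =>
      (∀ a, a ∉ [10, 13, 14, 15, 16, 17] → M' a = M a) ∧
      ((M' 13 = 0 ∧ ∀ i : Fin q, R w (β i) → M (32 + n + i) ≠ 0) ∨
        ∃ i : Fin q, M' 13 = i + 1 ∧ R w (β i) ∧ M (32 + n + i) = 0) := by
  refine Runs.forDown (t := 8) (m := q)
    (fun j M' => (∀ a, a ∉ [10, 13, 14, 15, 16, 17] → M' a = M a) ∧
      ((M' 13 = 0 ∧ ∀ i : Fin q, j ≤ i → R w (β i) → M (32 + n + i) ≠ 0) ∨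
        ∃ i : Fin q, M' 13 = i + 1 ∧ R w (β i) ∧ M (32 + n + i) = 0)) hc.size (by omega)
      hc.zero ?_ ?_ ?_
  · exact ⟨fun a ha => by simp at ha; simp [ha], Or.inl ⟨by simp [h13], fun i hi => by omega⟩⟩
  · rintro j hj M₁ hr ⟨hM₁, h13'⟩
    have hc₁ : HasConstants n q k M₁ := hc.congr fun a ha => hM₁ a (by revert a; decide)
    refine ⟨hc₁.one, Runs.cons (t := 7) (Runs.read (β ⟨j, hj⟩) ?_ (by omega) ?_)⟩
    · simpa [hc₁.row] using hI ⟨j, hj⟩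
    have h9 : M₁ 9 = w := by rw [hM₁ 9 (by decide), hw]
    refine Runs.seq (t := 2) (t' := 5) ?_ le_rfl
    refine harc _ _ _ _ _ w (β ⟨j, hj⟩) (by simp [hc₁.offset]) (by simp [h9]) (by simp)
      (by decide) (by decide) ?_
    intro z e he
    have hskip : (R w (β ⟨j, hj⟩) → M (32 + n + j) ≠ 0) →
        (M₁ 13 = 0 ∧ ∀ i : Fin q, j ≤ i → R w (β i) → M (32 + n + i) ≠ 0) ∨
          ∃ i : Fin q, M₁ 13 = i + 1 ∧ R w (β i) ∧ M (32 + n + i) = 0 := by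
      intro h
      refine h13'.imp_left fun h' => ⟨h'.1, fun i hi hR => ?_⟩
      rcases hi.eq_or_lt with hi | hi
      · obtain rfl : i = ⟨j, hj⟩ := Fin.ext hi.symm
        exact h hR
      · exact h'.2 i hi hR
    refine Runs.ite (t := 4) (fun hne => ?_) (fun h0 => ?_)
    · obtain ⟨rfl, hR⟩ : e = 1 ∧ R w (β ⟨j, hj⟩) := by
        rcases he with he | he
        · exact he
        · simp [he.1] at hne
      refine Runs.cons (t := 3) (Runs.add ?_ (Runs.cons (t := 2) (Runs.load ?_ ?_)))
      · simp [hc₁.base']; omega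
      · have h1 := hU j hj
        rw [← hM₁ _ (by simp; omega)] at h1
        simp [hc₁.base', Function.update_apply]
        simp (disch := omega) only [if_neg]
        omega
      · have hload : M₁ (32 + n + j) = M (32 + n + j) := hM₁ _ (by simp; omega)
        refine Runs.ite (t := 1) (fun h1 => Runs.skip ?_) (fun h1 => Runs.add ?_ ?_)
        · refine ⟨by simp, fun a ha => ?_, ?_⟩
          · have := hM₁ a ha
            simp at ha
            simp [ha, this]
          · simp [hc₁.base', Function.update_apply] at h1
            simp (disch := omega) only [if_neg] at h1
            simpa using hskip fun _ => by omega
        · simp [hc₁.one]; omega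
        · refine ⟨by simp, fun a ha => ?_, Or.inr ⟨⟨j, hj⟩, by simp [hc₁.one], hR, ?_⟩⟩
          · have := hM₁ a ha
            simp at ha
            simp [ha, this]
          · simp [hc₁.base', Function.update_apply] at h1
            simp (disch := omega) only [if_neg] at h1
            change M (32 + n + j) = 0
            omega
    · obtain ⟨rfl, hR⟩ : e = 0 ∧ ¬ R w (β ⟨j, hj⟩) := by
        rcases he with he | he
        · simp [he.1] at h0
        · exact he
      refine (Runs.skip (Q := _) ?_).mono (by omega) fun _ h => h
      refine ⟨by simp, fun a ha => ?_, ?_⟩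
      · have := hM₁ a ha
        simp at ha
        simp [ha, this]
      · simpa using hskip fun h => absurd h hR
  · rintro M' ⟨h1, h2⟩
    exact ⟨h1, h2.imp_left fun h => ⟨h.1, fun i hR => h.2 i (by omega) hR⟩⟩

theorem runs_mark (hW : 5 * n + 100 ≤ W) (hqn : q ≤ n)
    (hI : ∀ i : Fin q, (I.getD 2 []).getD i 0 = β i) (harc : DecidesArc I W R arc)
    (hc : HasConstants n q k M) {y : Fin n} (hy : M 8 = y) :
    Runs I W (markProgram arc) M (2 + q * 8) fun M' =>
      (∀ a, a ∉ [10, 14, 15, 16] → (a < 32 ∨ 32 + n ≤ a) → M' a = M a) ∧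
      ∀ i : Fin q, (M' (32 + i) = 0 ↔ M (32 + i) = 0 ∧ ¬ R y (β i)) ∧
        (M (32 + i) ≤ 1 → M' (32 + i) ≤ 1) := by
  refine Runs.forDown (t := 6) (m := q)
    (fun j M' => (∀ a, a ∉ [10, 14, 15, 16] → (a < 32 ∨ 32 + n ≤ a) → M' a = M a) ∧
      ∀ i : Fin q, (M' (32 + i) = 0 ↔ M (32 + i) = 0 ∧ (j ≤ i → ¬ R y (β i))) ∧
        (M (32 + i) ≤ 1 → M' (32 + i) ≤ 1)) hc.size (by omega) hc.zero ?_ ?_ ?_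
  · refine ⟨fun a ha _ => by simp at ha; simp [ha], fun i => ?_⟩
    have : ¬ q ≤ i := by omega
    rw [Function.update_of_ne (by omega)]
    simp [this]
  · rintro j hj M₁ hr ⟨hM₁, hF⟩
    have hc₁ : HasConstants n q k M₁ :=
      hc.congr_of_lt fun a ha h => hM₁ a (by clear h; revert a; decide) (Or.inl h)
    refine ⟨hc₁.one, Runs.cons (t := 5) (Runs.read (β ⟨j, hj⟩) ?_ (by omega) ?_)⟩
    · simpa [hc₁.row] using hI ⟨j, hj⟩
    have h8 : M₁ 8 = y := by rw [hM₁ 8 (by decide) (by simp), hy]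
    refine Runs.seq (t := 2) (t' := 3) ?_ le_rfl
    refine harc _ _ _ _ _ y (β ⟨j, hj⟩) (by simp [hc₁.offset]) (by simp [h8]) (by simp)
      (by decide) (by decide) ?_
    intro z e he
    refine Runs.ite (t := 2) (fun hne => ?_) (fun h0 => ?_)
    · obtain ⟨rfl, hR⟩ : e = 1 ∧ R y (β ⟨j, hj⟩) := by
        rcases he with he | he
        · exact he
        · simp [he.1] at hne
      refine Runs.cons (t := 1) (Runs.add ?_ (Runs.store ?_ ?_))
      · simp [hc₁.base]; omega
      · simp [hc₁.one]; omega
      · have h18 := hc₁.base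
        have h1 := hc₁.one
        refine ⟨by simp [Function.update_apply, h18]; omega, fun a ha han => ?_, fun i => ?_⟩
        · have := hM₁ a ha han
          simp at ha
          simp [ha, this, Function.update_apply, h18]
          omega
        · by_cases hij : i = ⟨j, hj⟩
          · subst hij
            simp [h18, h1, hR]
          · have hij' : (i : ℕ) ≠ j := fun h => hij (Fin.ext h)
            have hle : j ≤ i ↔ j + 1 ≤ (i : ℕ) := by omega
            rw [hle]
            simp (disch := omega) only [Function.update_self, Function.update_of_ne, h18]
            exact hF i
    · obtain ⟨rfl, hR⟩ : e = 0 ∧ ¬ R y (β ⟨j, hj⟩) := by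
        rcases he with he | he
        · simp [he.1] at h0
        · exact he
      refine (Runs.skip (Q := _) ?_).mono (by omega) fun _ h => h
      refine ⟨by simp, fun a ha han => ?_, fun i => ?_⟩
      · have := hM₁ a ha han
        simp at ha
        simp [ha, this]
      · have hle : (j ≤ i → ¬ R y (β i)) ↔ (j + 1 ≤ i → ¬ R y (β i)) := by
          refine ⟨fun h h' => h (by omega), fun h h' => ?_⟩
          rcases h'.eq_or_lt with h' | h'
          · obtain rfl : i = ⟨j, hj⟩ := Fin.ext h'.symm
            exact hR
          · exact h h'
        rw [hle]
        simp (disch := omega) only [Function.update_of_ne]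
        exact hF i
  · rintro M' ⟨h1, h2⟩
    exact ⟨h1, fun i => ⟨by simpa using (h2 i).1, (h2 i).2⟩⟩

/-- The part of the matching found by the greedy procedure in the vertices from `j` on. -/
structure IsGreedyMatching (R : Fin n → Fin n → Prop) (y : Fin n) (B : Finset (Fin n)) (j : ℕ)
    (Mt : Finset (Fin n × Fin n)) : Prop extends IsMatchingInto R (R y) B Mt where
  le : ∀ p ∈ Mt, j ≤ (p.1 : ℕ)
  maximal : ∀ w : Fin n, ∀ b, j ≤ (w : ℕ) → R y w → b ∈ B → R w b → ∃ p ∈ Mt, p.1 = w ∨ p.2 = b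

theorem IsGreedyMatching.of_succ {y w : Fin n} {Mt : Finset (Fin n × Fin n)}
    (h : IsGreedyMatching R y B (w + 1) Mt)
    (hw : R y w → ∀ b ∈ B, R w b → ∃ p ∈ Mt, p.2 = b) : IsGreedyMatching R y B w Mt := by
  refine ⟨h.toIsMatchingInto, fun p hp => (Nat.le_succ _).trans (h.le p hp),
    fun w' b hw' hyw' hb hR => ?_⟩
  rcases hw'.eq_or_lt with hw' | hw'
  · obtain rfl := Fin.ext hw'
    obtain ⟨p, hp, hpb⟩ := hw hyw' b hb hR
    exact ⟨p, hp, Or.inr hpb⟩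
  · exact h.maximal w' b hw' hyw' hb hR

theorem IsGreedyMatching.insert {y w b : Fin n} {Mt : Finset (Fin n × Fin n)}
    (h : IsGreedyMatching R y B (w + 1) Mt) (hyw : R y w) (hb : b ∈ B) (hwb : R w b)
    (hnew : ∀ p ∈ Mt, p.2 ≠ b) :
    (w, b) ∉ Mt ∧ IsGreedyMatching R y B w (insert (w, b) Mt) := by
  have hfst : ∀ p ∈ Mt, p.1 ≠ w := fun p hp hpw => by
    have := h.le p hp
    rw [hpw] at this
    omega
  have hnot : (w, b) ∉ Mt := fun h' => hnew _ h' rfl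
  refine ⟨hnot, ⟨⟨?_, ?_, ?_, ?_, ?_⟩, ?_, fun w' b' hw' hyw' hb' hR => ?_⟩⟩
  · simpa [hyw] using h.left
  · simpa [hb] using h.right
  · simpa [hwb] using h.rel
  · rw [Finset.coe_insert, Set.injOn_insert (by simpa using hnot)]
    refine ⟨h.injOn_fst, ?_⟩
    rintro ⟨p, hp, hpw⟩
    exact hfst p hp hpw
  · rw [Finset.coe_insert, Set.injOn_insert (by simpa using hnot)]
    refine ⟨h.injOn_snd, ?_⟩
    rintro ⟨p, hp, hpw⟩
    exact hnew p hp hpw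
  · intro p hp
    rcases Finset.mem_insert.1 hp with rfl | hp
    · exact le_rfl
    · exact (Nat.le_succ _).trans (h.le p hp)
  · rcases hw'.eq_or_lt with hw' | hw'
    · exact ⟨(w, b), Finset.mem_insert_self _ _, Or.inl (Fin.ext hw')⟩
    · obtain ⟨p, hp, h⟩ := h.maximal w' b' hw' hyw' hb' hR
      exact ⟨p, Finset.mem_insert_of_mem hp, h⟩

theorem IsMatchingInto.card_le {V : Type*} {R : V → V → Prop} {Y : V → Prop} {B : Finset V}
    {Mt : Finset (V × V)} (h : IsMatchingInto R Y B Mt) : Mt.card ≤ B.card :=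
  Finset.card_le_card_of_injOn Prod.snd (fun p hp => h.right p hp) h.injOn_snd

/-- A vertex reached from `y` is either matched to a free element of `B`, or all its arcs into `B`
already end in matched elements. The greedy result is therefore maximal, though not necessarily
maximum. -/
theorem runs_match (hW : 5 * n + 100 ≤ W) (hqn : q ≤ n) (hB : B.card = q)
    (hβ : Function.Injective β) (hβB : ∀ b, b ∈ B ↔ ∃ i, β i = b)
    (hI : ∀ i : Fin q, (I.getD 2 []).getD i 0 = β i) (harc : DecidesArc I W R arc)
    (hc : HasConstants n q k M) {y : Fin n} (hy : M 8 = y) (h12 : M 12 = 0)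
    (hU : ∀ i < q, M (32 + n + i) = 0) :
    Runs I W (matchProgram arc) M (2 + n * (q * 10 + 13)) fun M' =>
      (∀ a, a ∉ [9, 10, 12, 13, 14, 15, 16, 17] → a < 32 + n → M' a = M a) ∧
      ∃ Mt, IsMaximalMatchingInto R (R y) B Mt ∧ M' 12 = Mt.card := by
  refine Runs.forDown (t := q * 10 + 11) (m := n) (fun j M' =>
      (∀ a, a ∉ [9, 10, 12, 13, 14, 15, 16, 17] → a < 32 + n → M' a = M a) ∧
      ∃ Mt, IsGreedyMatching R y B j Mt ∧ M' 12 = Mt.card ∧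
        (∀ i : Fin q, M' (32 + n + i) ≤ 1 ∧
          (M' (32 + n + i) = 0 ↔ ∀ p ∈ Mt, p.2 ≠ β i))) hc.card (by omega) hc.zero ?_ ?_ ?_
  · refine ⟨fun a ha _ => by simp at ha; simp [ha], ∅, ⟨by constructor <;> simp, by simp,
      fun w b hw => by omega⟩, by simp [h12], fun i => ?_⟩
    rw [Function.update_of_ne (by omega), hU i i.2]
    simp
  · rintro j hj M₁ hr ⟨hM₁, Mt, hMt, h12', hU₁⟩
    have hc₁ : HasConstants n q k M₁ :=
      hc.congr_of_lt fun a ha h => hM₁ a (by clear h; revert a; decide) (by omega)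
    have h8 : M₁ 8 = y := by rw [hM₁ 8 (by decide) (by omega), hy]
    have hcard : Mt.card ≤ q := hB ▸ hMt.card_le
    refine ⟨hc₁.one, Runs.seq (t := 2) (t' := q * 10 + 9) ?_ (by omega)⟩
    refine harc _ _ _ _ _ y ⟨j, hj⟩ (by simp [hc₁.offset]) (by simp [h8]) (by simp)
      (by decide) (by decide) ?_
    intro z e he
    refine Runs.ite (t := q * 10 + 8) (fun hne => ?_) (fun h0 => ?_)
    · obtain ⟨rfl, hyw⟩ : e = 1 ∧ R y ⟨j, hj⟩ := by
        rcases he with he | he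
        · exact he
        · simp [he.1] at hne
      refine Runs.cons (t := q * 10 + 7) (Runs.const (by omega) ?_)
      refine Runs.seq (t := 2 + q * 10) (t' := 5) ?_ (by omega)
      have hU₂ : ∀ i, Function.update (Function.update (Function.update
          (Function.update M₁ 9 j) 16 z) 15 1) 13 0 (32 + n + i) = M₁ (32 + n + i) := fun i => by
        simp (disch := omega) only [Function.update_of_ne]
      refine (runs_search (w := ⟨j, hj⟩) hW hqn hI harc (hc₁.congr fun a ha => ?_) ?_ ?_ ?_).mono
        le_rfl ?_
      · simp at ha
        have : a ≠ 9 ∧ a ≠ 16 ∧ a ≠ 15 ∧ a ≠ 13 := by omega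
        simp [this]
      · simp
      · simp
      · exact fun i hi => (hU₂ i).symm ▸ (hU₁ ⟨i, hi⟩).1
      rintro M₂ ⟨hM₂, h13⟩
      simp only [hU₂] at h13
      have hM₃ : ∀ a, a ∉ [9, 10, 13, 14, 15, 16, 17] → M₂ a = M₁ a := fun a ha => by
        simp at ha
        rw [hM₂ a (by simp [ha])]
        simp [ha]
      have hM₂9 : M₂ 9 = j := by rw [hM₂ 9 (by decide)]; simp
      have hfr : ∀ a, a ∉ [9, 10, 12, 13, 14, 15, 16, 17] → a < 32 + n → M₂ a = M a :=
        fun a ha han => by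
          rw [← hM₁ a ha han]
          simp at ha
          exact hM₃ a (by simp [ha])
      have hc₂ : HasConstants n q k M₂ := hc₁.congr fun a ha => hM₃ a (by revert a; decide)
      have hU₃ : ∀ i, M₂ (32 + n + i) = M₁ (32 + n + i) := fun i => hM₃ _ (by simp; omega)
      refine Runs.ite (t := 4) (fun hne => ?_) (fun h0 => ?_)
      · obtain ⟨i, hi13, hR, hi0⟩ := h13.resolve_left fun h => hne h.1
        obtain ⟨hnot, hins⟩ := IsGreedyMatching.insert (w := ⟨j, hj⟩) (b := β i) hMt hyw
          ((hβB _).2 ⟨i, rfl⟩) hR ((hU₁ i).2.1 hi0)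
        have h1 := hc₂.one
        have h19 := hc₂.base'
        have h12'' : M₂ 12 = Mt.card := by rw [hM₃ 12 (by decide), h12']
        refine Runs.cons (t := 3) (Runs.sub ?_ (Runs.cons (t := 2) (Runs.add ?_
          (Runs.cons (t := 1) (Runs.store ?_ (Runs.add ?_ ?_))))))
        · omega
        · simp [h19, hi13, h1]; omega
        · simp [h1]; omega
        · simp [h19, hi13, h1, Function.update_apply]
          simp (disch := omega) only [if_neg]
          omega
        · have hst : M₂ 19 + (M₂ 13 - 1) = 32 + n + i := by rw [h19, hi13]; simp
          simp (disch := omega) only [Function.update_self, Function.update_of_ne, hst, h1]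
          refine ⟨hM₂9, fun a ha han => ?_, insert (⟨j, hj⟩, β i) Mt, hins, ?_, fun i' => ?_⟩
          · rw [← hfr a ha han]
            simp at ha
            simp (disch := omega) only [Function.update_of_ne]
          · rw [Finset.card_insert_of_notMem hnot, h12'']
          · by_cases hii : i' = i
            · subst hii
              simp
            · have hii' : (i' : ℕ) ≠ i := fun h => hii (Fin.ext h)
              simp (disch := omega) only [Function.update_of_ne, hU₃]
              refine ⟨(hU₁ i').1, ?_⟩
              rw [(hU₁ i').2]
              have : β i ≠ β i' := fun h => hii (hβ h).symm
              simp [this]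
      · have h13' := h13.resolve_right fun ⟨i, hi, _⟩ => by omega
        refine (Runs.skip (Q := _) ?_).mono (by omega) fun _ h => h
        refine ⟨hM₂9, hfr, Mt, ?_, by rw [hM₃ 12 (by decide), h12'], fun i => by
          rw [hU₃]; exact hU₁ i⟩
        refine IsGreedyMatching.of_succ (w := ⟨j, hj⟩) hMt fun _ b hb hR => ?_
        obtain ⟨i, rfl⟩ := (hβB b).1 hb
        by_contra! hcon
        exact h13'.2 i hR ((hU₁ i).2.2 hcon)
    · obtain ⟨rfl, hyw⟩ : e = 0 ∧ ¬ R y ⟨j, hj⟩ := by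
        rcases he with he | he
        · simp [he.1] at h0
        · exact he
      refine (Runs.skip (Q := _) ?_).mono (by omega) fun _ h => h
      refine ⟨by simp, fun a ha han => ?_, Mt, IsGreedyMatching.of_succ (w := ⟨j, hj⟩) hMt
        fun h => absurd h hyw, by simp [h12'], fun i => ?_⟩
      · have := hM₁ a ha han
        simp at ha
        simp [ha, this]
      · simp (disch := omega) only [Function.update_of_ne]
        exact hU₁ i
  · rintro M' ⟨h1, Mt, hMt, h2, -⟩
    exact ⟨h1, Mt, ⟨hMt.toIsMatchingInto, fun w b hw hb hR =>
      hMt.maximal w b (Nat.zero_le _) hw hb hR⟩, h2⟩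

/-- An unmarked position certifies that all inneighbours are rich, a newly marked one that some
inneighbour is poor. A vertex may be both, since maximal matchings differ in size, so the two
implications are not converse to each other; the one matching computed for a vertex provides one of
the two certificates. -/
theorem runs_pass (hW : 5 * n + 100 ≤ W) (hqn : q ≤ n) (hkq : 5 * k ≤ q) (hB : B.card = q)
    (hβ : Function.Injective β) (hβB : ∀ b, b ∈ B ↔ ∃ i, β i = b)
    (hI : ∀ i : Fin q, (I.getD 2 []).getD i 0 = β i) (harc : DecidesArc I W R arc)
    (hc : HasConstants n q k M) (hF : ∀ i : Fin q, M (32 + i) ≤ 1) :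
    Runs I W (passProgram arc) M (2 + n * (n * (q * 10 + 13) + q * 18 + 15 + 2)) fun M' =>
      HasConstants n q k M' ∧ ∀ i : Fin q, M' (32 + i) ≤ 1 ∧
        (M' (32 + i) = 0 → M (32 + i) = 0 ∧ ∀ y, R y (β i) → IsRich R B k y) ∧
        (M' (32 + i) ≠ 0 → M (32 + i) ≠ 0 ∨ ∃ y, IsPoor R B k y ∧ R y (β i)) := by
  classical
  refine Runs.forDown (t := n * (q * 10 + 13) + q * 18 + 15) (m := n)
    (fun j M' => HasConstants n q k M' ∧ ∀ i : Fin q, M' (32 + i) ≤ 1 ∧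
        (M' (32 + i) = 0 → M (32 + i) = 0 ∧
          ∀ y : Fin n, j ≤ (y : ℕ) → R y (β i) → IsRich R B k y) ∧
        (M' (32 + i) ≠ 0 → M (32 + i) ≠ 0 ∨ ∃ y, IsPoor R B k y ∧ R y (β i)))
    hc.card (by omega) hc.zero ?_ ?_ ?_
  · refine ⟨hc.congr fun a ha => ?_, fun i => ?_⟩
    · rw [Function.update_of_ne (by rintro rfl; simp at ha)]
    · rw [Function.update_of_ne (by omega)]
      exact ⟨hF i, fun h => ⟨h, fun y hy => by omega⟩, fun h => Or.inl h⟩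
  · rintro j hj M₁ hr ⟨hc₁, hF₁⟩
    refine ⟨hc₁.one, ?_⟩
    refine Runs.seq (t := 1) (t' := n * (q * 10 + 13) + q * 18 + 14) (Runs.const (by omega) ?_)
      (by omega)
    refine Runs.seq (t := 1) (t' := n * (q * 10 + 13) + q * 18 + 13) (Runs.const (by omega) ?_)
      (by omega)
    refine Runs.seq (t := 2 + q * 6) (t' := n * (q * 10 + 13) + q * 12 + 11) ?_ (by omega)
    refine (runs_count (k := k) (y := ⟨j, hj⟩) hW hqn hI harc (hc₁.congr fun a ha => ?_)
      (by simp) (by simp)).mono le_rfl ?_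
    · simp at ha
      have : a ≠ 8 ∧ a ≠ 11 ∧ a ≠ 12 := by omega
      simp [this]
    rintro M₂ ⟨hM₂, S, hS, hS11⟩
    have hM₂' : ∀ a, a ∉ [8, 10, 11, 12, 14, 15, 16] → M₂ a = M₁ a := fun a ha => by
      simp at ha
      rw [hM₂ a (by simp [ha])]
      simp [ha]
    have hc₂ : HasConstants n q k M₂ := hc₁.congr fun a ha => hM₂' a (by revert a; decide)
    have hM₂8 : M₂ 8 = j := by rw [hM₂ 8 (by decide)]; simp
    have hM₂12 : M₂ 12 = 0 := by rw [hM₂ 12 (by decide)]; simp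
    refine Runs.seq (t := 2 + q * 4) (t' := n * (q * 10 + 13) + q * 8 + 9) ?_ (by omega)
    refine (runs_reset hW hqn hc₂).mono le_rfl ?_
    rintro M₃ ⟨hM₃, hU⟩
    have hc₃ : HasConstants n q k M₃ :=
      hc₂.congr_of_lt fun a ha h => hM₃ a (by clear h; revert a; decide) (by omega)
    refine Runs.seq (t := 2 + n * (q * 10 + 13)) (t' := q * 8 + 7) ?_ (by omega)
    refine (runs_match (y := ⟨j, hj⟩) hW hqn hB hβ hβB hI harc hc₃
      (by rw [hM₃ 8 (by decide) (by omega), hM₂8])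
      (by rw [hM₃ 12 (by decide) (by omega), hM₂12]) hU).mono le_rfl ?_
    rintro M₄ ⟨hM₄, Mt, hMt, hM₄12⟩
    have hc₄ : HasConstants n q k M₄ :=
      hc₃.congr_of_lt fun a ha h => hM₄ a (by clear h; revert a; decide) (by omega)
    have hM₄11 : M₄ 11 = S.card := by
      rw [hM₄ 11 (by decide) (by omega), hM₃ 11 (by decide) (by omega), hS11]
    have hM₄8 : M₄ 8 = j := by
      rw [hM₄ 8 (by decide) (by omega), hM₃ 8 (by decide) (by omega), hM₂8]
    have hF₄ : ∀ i : Fin q, M₄ (32 + i) = M₁ (32 + i) := fun i => by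
      rw [hM₄ _ (by simp; omega) (by omega), hM₃ _ (by simp; omega) (by omega),
        hM₂' _ (by simp; omega)]
    -- If the current vertex is certified rich, nothing is marked and the invariant extends to it
    -- unchanged.
    have hrich : IsRich R B k ⟨j, hj⟩ → ∀ i : Fin q, M₁ (32 + i) ≤ 1 ∧
        (M₁ (32 + i) = 0 → M (32 + i) = 0 ∧
          ∀ y : Fin n, j ≤ (y : ℕ) → R y (β i) → IsRich R B k y) ∧
        (M₁ (32 + i) ≠ 0 → M (32 + i) ≠ 0 ∨ ∃ y, IsPoor R B k y ∧ R y (β i)) := by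
      refine fun h i => ⟨(hF₁ i).1, fun h0 => ⟨((hF₁ i).2.1 h0).1, fun y hjy hR => ?_⟩,
        (hF₁ i).2.2⟩
      rcases hjy.eq_or_lt with hjy | hjy
      · obtain rfl : y = ⟨j, hj⟩ := Fin.ext hjy.symm
        exact h
      · exact ((hF₁ i).2.1 h0).2 y hjy hR
    have h4 := hc₄.two_mul
    have h5 := hc₄.five_mul
    refine Runs.seq (t := 1) (t' := q * 8 + 6) (Runs.sub (by omega) ?_) (by omega)
    have hc₅ : ∀ v, HasConstants n q k (Function.update M₄ 15 v) := fun v =>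
      hc₄.congr fun a ha => by rw [Function.update_of_ne (by rintro rfl; simp at ha)]
    refine Runs.ite (t := q * 8 + 5) (fun hlt => ?_) (fun h0 => ?_)
    · have hlt : S.card < 2 * k := by
        simp [h4, hM₄11] at hlt
        omega
      refine Runs.seq (t := 1) (t' := q * 8 + 4) (Runs.sub ?_ ?_) (by omega)
      · simp [h5]; omega
      simp only [Function.update_idem]
      refine Runs.ite (t := q * 8 + 3) (fun hlt' => ?_) (fun h0 => ?_)
      · have hlt' : Mt.card < 5 * k := by
          simp [h5, hM₄12] at hlt'
          omega
        have hpoor : IsPoor R B k ⟨j, hj⟩ := by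
          refine ⟨fun S' hS' hR => lt_of_le_of_lt ?_ hlt, Mt, hMt, hlt'⟩
          have hsub : S' ⊆ S.image β := by
            intro b hb
            obtain ⟨i, rfl⟩ := (hβB b).1 (hS' hb)
            exact Finset.mem_image_of_mem _ ((hS i).2 (hR _ hb))
          exact (Finset.card_le_card hsub).trans Finset.card_image_le
        refine (runs_mark (y := ⟨j, hj⟩) hW hqn hI harc (hc₅ _) (by simp [hM₄8])).mono
          (by omega) ?_
        rintro M₅ ⟨hM₅, hF₅⟩
        refine ⟨?_, (hc₅ _).congr_of_lt fun a ha h =>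
          hM₅ a (by clear h; revert a; decide) (Or.inl h), fun i => ?_⟩
        · rw [hM₅ 8 (by decide) (by simp)]
          simp [hM₄8]
        have hi := hF₅ i
        rw [Function.update_of_ne (by omega), hF₄] at hi
        refine ⟨hi.2 (hF₁ i).1, fun h0 => ?_, fun h0 => ?_⟩
        · have h := hi.1.1 h0
          refine ⟨((hF₁ i).2.1 h.1).1, fun y hjy hR => ?_⟩
          rcases hjy.eq_or_lt with hjy | hjy
          · obtain rfl : y = ⟨j, hj⟩ := Fin.ext hjy.symm
            exact absurd hR h.2
          · exact ((hF₁ i).2.1 h.1).2 y hjy hR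
        · by_cases h1 : M₁ (32 + i) = 0
          · by_cases hR : R ⟨j, hj⟩ (β i)
            · exact Or.inr ⟨_, hpoor, hR⟩
            · exact absurd (hi.1.2 ⟨h1, hR⟩) h0
          · exact (hF₁ i).2.2 h1
      · have hle : 5 * k ≤ Mt.card := by
          simp [h5, hM₄12] at h0
          omega
        refine (Runs.skip (Q := _) ?_).mono (by omega) fun _ h => h
        refine ⟨by simp [hM₄8], hc₅ _, fun i => ?_⟩
        rw [Function.update_of_ne (by omega), hF₄]
        exact hrich (Or.inr ⟨Mt, hMt.toIsMatchingInto, hle⟩) i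
    · have hle : 2 * k ≤ S.card := by
        simp [h4, hM₄11] at h0
        omega
      refine (Runs.skip (Q := _) ?_).mono (by omega) fun _ h => h
      refine ⟨by simp [hM₄8], hc₅ _, fun i => ?_⟩
      rw [Function.update_of_ne (by omega), hF₄]
      refine hrich (Or.inl ⟨S.image β, fun b hb => ?_, fun b hb => ?_, ?_⟩) i
      · obtain ⟨i, -, rfl⟩ := Finset.mem_image.1 hb
        exact (hβB _).2 ⟨i, rfl⟩
      · obtain ⟨i, hi, rfl⟩ := Finset.mem_image.1 hb
        exact (hS i).1 hi
      · rwa [Finset.card_image_of_injective _ hβ]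
  · rintro M' ⟨h1, h2⟩
    exact ⟨h1, fun i => ⟨(h2 i).1, fun h => ⟨((h2 i).2.1 h).1, fun y =>
      ((h2 i).2.1 h).2 y (Nat.zero_le _)⟩, (h2 i).2.2⟩⟩

theorem runs_output (hW : 5 * n + 100 ≤ W) (hqn : q ≤ n)
    (hI : ∀ i : Fin q, (I.getD 2 []).getD i 0 = β i) (hc : HasConstants n q k M)
    (hF : ∀ i : Fin q, M (32 + i) ≤ 1) (hex : ∃ i : Fin q, M (32 + i) = 0) :
    Runs I W outputProgram M (2 + q * 6) fun M' => ∃ i : Fin q, M' 0 = β i ∧ M (32 + i) = 0 := by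
  refine Runs.forDown (t := 4) (m := q) (fun j M' => (∀ a, a ∉ [0, 10, 16, 17] → M' a = M a) ∧
      ((∃ i : Fin q, M' 0 = β i ∧ M (32 + i) = 0) ∨ ∀ i : Fin q, j ≤ i → M (32 + i) ≠ 0))
      hc.size (by omega) hc.zero ?_ ?_ ?_
  · exact ⟨fun a ha => by simp at ha; simp [ha], Or.inr fun i hi => by omega⟩
  · rintro j hj M₁ hr ⟨hM₁, h⟩
    have hc₁ : HasConstants n q k M₁ := hc.congr fun a ha => hM₁ a (by revert a; decide)
    have h18 := hc₁.base
    have hload : M₁ (32 + j) = M (32 + j) := hM₁ _ (by simp; omega)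
    have hFj : M (32 + j) ≤ 1 := hF ⟨j, hj⟩
    refine ⟨hc₁.one, Runs.cons (t := 3) (Runs.add ?_ (Runs.cons (t := 2) (Runs.load ?_ ?_)))⟩
    · simp [h18]; omega
    · simp (disch := omega) only [Function.update_self, Function.update_of_ne, h18, hload]
      omega
    · simp (disch := omega) only [Function.update_self, Function.update_of_ne, h18, hload]
      refine Runs.ite (t := 1) (fun h1 => Runs.skip ?_) (fun h1 => ?_)
      · rw [Function.update_self] at h1
        refine ⟨by simp, fun a ha => ?_, ?_⟩
        · have := hM₁ a ha
          simp at ha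
          simp [ha, this]
        · refine h.imp (fun ⟨i, hi⟩ => ⟨i, by simpa using hi⟩) fun h i hi => ?_
          rcases hi.eq_or_lt with hi | hi
          · rwa [← hi]
          · exact h i hi
      · rw [Function.update_self] at h1
        refine Runs.read (β ⟨j, hj⟩) ?_ (by omega) ?_
        · simpa [hc₁.row] using hI ⟨j, hj⟩
        · refine ⟨by simp, fun a ha => ?_, Or.inl ⟨⟨j, hj⟩, by simp, h1⟩⟩
          have := hM₁ a ha
          simp at ha
          simp [ha, this]
  · rintro M' ⟨-, h⟩
    exact h.resolve_right fun h => hex.elim fun i hi => h i (Nat.zero_le _) hi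

theorem runs_init {m s t : ℕ} (hW : 5 * n + 100 ≤ W) (hqn : q ≤ n) (hk : 5 * (m + s) ≤ q)
    (hI : I.getD 0 [] = [n, m, s, t, q]) :
    Runs I W initProgram (fun _ => 0) 15 fun M' =>
      HasConstants n q (m + s) M' ∧ ∀ a, 32 ≤ a → M' a = 0 := by
  unfold initProgram
  rw [List.getD_eq_getElem?_getD] at hI
  refine Runs.cons (Runs.const (by omega) ?_)
  refine Runs.cons (Runs.const (by omega) ?_)
  refine Runs.cons (Runs.const (by omega) ?_)
  refine Runs.cons (Runs.const (by omega) ?_)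
  refine Runs.cons (Runs.read n (by simp [hI]) (by omega) ?_)
  refine Runs.cons (Runs.read m (by simp [hI]) (by omega) ?_)
  refine Runs.cons (Runs.const (by omega) ?_)
  refine Runs.cons (Runs.read s (by simp [hI]) (by omega) ?_)
  refine Runs.cons (Runs.const (by omega) ?_)
  refine Runs.cons (Runs.read q (by simp [hI]) (by omega) ?_)
  refine Runs.cons (Runs.add (by simp; omega) ?_)
  refine Runs.cons (Runs.add (by simp; omega) ?_)
  refine Runs.cons (Runs.add (by simp; omega) ?_)
  refine Runs.cons (Runs.add (by simp; omega) ?_)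
  refine Runs.add (by simp; omega) ?_
  refine ⟨?_, fun a ha => ?_⟩
  · constructor <;> simp <;> ring
  · simp (disch := omega) only [Function.update_of_ne]

end Program

/-! ### Reading the encoded instance. -/

section Input

variable {n m s t : ℕ} (H : MultiDigraph (Fin m) (Fin s)) (u : Fin t → Fin m)
  (T : Digraph (Fin n)) (v : Fin t → Fin n) (LA LB LC : List (Fin n))

theorem encodeInput_getD_zero :
    (encodeInput H u T v LA LB LC).getD 0 [] = [n, m, s, t, LB.length] := by
  simp [encodeInput]

theorem encodeInput_getD_two : (encodeInput H u T v LA LB LC).getD 2 [] = LB.map Fin.val := by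
  simp [encodeInput]

theorem encodeInput_getD_adj (x y : Fin n) :
    ((encodeInput H u T v LA LB LC).getD (8 + x) []).getD y 0 = 1 ∧ T.Adj x y ∨
      ((encodeInput H u T v LA LB LC).getD (8 + x) []).getD y 0 = 0 ∧ ¬ T.Adj x y := by
  classical
  have h : (encodeInput H u T v LA LB LC).getD (8 + x) [] =
      List.ofFn fun y : Fin n => if T.Adj x y then 1 else 0 := by
    simp only [encodeInput]
    rw [List.getD_append_right _ _ _ _ (by simp)]
    simp
  rw [h]
  by_cases hxy : T.Adj x y <;> simp [hxy]

end Input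

/-! ### Correctness and running time of the whole algorithm. -/

/-- The algorithm outputs a vertex `x` of `B` such that its inneighbours have many short walks
to `B` and its outneighbours have many short walks from `B`. -/
theorem runs_irrelevantVertexProgram {n m s t : ℕ} (H : MultiDigraph (Fin m) (Fin s))
    (u : Fin t → Fin m) {T : Digraph (Fin n)} (v : Fin t → Fin n) (LA LB LC : List (Fin n))
    {B : Finset (Fin n)} {W : ℕ} (hT : T.IsSemicomplete) (hB : B.card = tripleSize (m + s))
    (hLB : LB.Nodup) (hLB' : LB.toFinset = B) (hW : 5 * n + 100 ≤ W) :
    Runs (encodeInput H u T v LA LB LC) W irrelevantVertexProgram (fun _ => 0)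
      (200 * (tripleSize (m + s) ^ 2 * n ^ 2)) fun M => ∃ x ∈ B, M 0 = x.val ∧
        (∀ y, T.Adj y x → IsRich T.Adj B (m + s) y) ∧
        ∀ z, T.Adj x z → IsRich (flip T.Adj) B (m + s) z := by
  set k := m + s with hk
  have hq : tripleSize k = 80 * k ^ 2 + 80 * k + 5 := rfl
  set q := tripleSize k
  have hlen : LB.length = q := by rw [← hB, ← hLB', List.toFinset_card_of_nodup hLB]
  have hqn : q ≤ n := by simpa [hB] using Finset.card_le_univ B
  have hkq : 5 * k ≤ q := by omega
  set β : Fin q → Fin n := fun i => LB.get (i.cast hlen.symm) with hβdef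
  have hβ : Function.Injective β := fun i j hij => by
    have := hLB.injective_get hij
    simpa [Fin.ext_iff] using this
  have hβB : ∀ b, b ∈ B ↔ ∃ i, β i = b := fun b => by
    rw [← hLB', List.mem_toFinset, List.mem_iff_get]
    exact ⟨fun ⟨i, hi⟩ => ⟨i.cast hlen, by simpa [hβdef] using hi⟩, fun ⟨i, hi⟩ => ⟨_, hi⟩⟩
  set I := encodeInput H u T v LA LB LC
  have hI2 : ∀ i : Fin q, (I.getD 2 []).getD i 0 = β i := fun i => by
    rw [encodeInput_getD_two]
    simp [hβdef, hlen]
  have hI0 : I.getD 0 [] = [n, m, s, t, q] := by rw [encodeInput_getD_zero, hlen]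
  have hIA := encodeInput_getD_adj H u T v LA LB LC
  -- The actual cost is of order `q * n ^ 2`. As `5 ≤ q` and `5 ≤ n`, substituting `q = 5 + a` and
  -- `n = 5 + b` leaves a comparison of polynomials with natural coefficients.
  have htime : 15 + ((2 + n * (n * (q * 10 + 13) + q * 18 + 15 + 2)) +
      ((2 + n * (n * (q * 10 + 13) + q * 18 + 15 + 2)) + (2 + q * 6))) ≤
        200 * (q ^ 2 * n ^ 2) := by
    have hq1 : 5 ≤ q := by omega
    have hn1 : 5 ≤ n := by omega
    obtain ⟨a, ha⟩ := Nat.exists_eq_add_of_le hq1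
    obtain ⟨b, hb⟩ := Nat.exists_eq_add_of_le hn1
    rw [ha, hb]
    ring_nf
    nlinarith [Nat.zero_le (a * b), Nat.zero_le (a * b ^ 2), Nat.zero_le (a ^ 2 * b),
      Nat.zero_le (a ^ 2 * b ^ 2)]
  refine (Runs.seq ?_ le_rfl).mono htime fun _ h => h
  refine (runs_init hW hqn hkq hI0).mono le_rfl ?_
  rintro M₁ ⟨hc₁, h0⟩
  refine Runs.seq ?_ le_rfl
  refine (runs_pass hW hqn hkq hB hβ hβB hI2
    (decidesArc_readArc (by omega) hIA) hc₁ fun i => by rw [h0 _ (by omega)]; omega).mono le_rfl ?_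
  rintro M₂ ⟨hc₂, hF₂⟩
  refine Runs.seq ?_ le_rfl
  refine (runs_pass hW hqn hkq hB hβ hβB hI2
    (decidesArc_readArcRev (by omega) hIA) hc₂ fun i => (hF₂ i).1).mono le_rfl ?_
  rintro M₃ ⟨hc₃, hF₃⟩
  -- Every mark comes from a poor vertex in one of the two directions, so at most `80k²` of the `q`
  -- positions are marked.
  have hex : ∃ i : Fin q, M₃ (32 + i) = 0 := by
    by_contra! hcon
    have := card_reached_by_poor_le_both (k := k) hT (subset_refl B) fun b hb => by
      obtain ⟨i, rfl⟩ := (hβB b).1 hb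
      rcases (hF₃ i).2.2 (hcon i) with h | h
      · rcases (hF₂ i).2.2 h with h | h
        · exact absurd (h0 _ (by omega)) h
        · exact Or.inl h
      · exact Or.inr h
    omega
  refine (runs_output hW hqn hI2 hc₃ (fun i => (hF₃ i).1) hex).mono le_rfl ?_
  rintro M₄ ⟨i, hi, hi0⟩
  have h2 := (hF₃ i).2.1 hi0
  exact ⟨β i, (hβB _).2 ⟨i, rfl⟩, hi, ((hF₂ i).2.1 h2.1).2, h2.2⟩

theorem Digraph.IsTriple.isTripleAround {V : Type*} {T : Digraph V} {q : ℕ} {A B C : Finset V}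
    (h : T.IsTriple q A B C) : ∃ a c : Fin q → V, IsTripleAround T.Adj B q a c := by
  obtain ⟨hAB, hBC, -, a, b, c, ha, hb, hc, hA, hB, hC, hab, hbc, hca⟩ := h
  have hBmem : ∀ x ∈ B, ∃ i, b i = x := fun x hx => by
    rw [← Finset.mem_coe, ← hB] at hx
    exact hx
  refine ⟨a, c, ?_, ha, hc, fun j hj => ?_, fun j hj => ?_, fun j x hx => ?_, fun j x hx => ?_,
    hca⟩
  · rw [← Set.ncard_coe_finset, ← hB, Set.ncard_range_of_injective hb, Nat.card_fin]
  · have : a j ∈ A := by rw [← Finset.mem_coe, ← hA]; exact ⟨j, rfl⟩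
    exact Finset.disjoint_left.1 hAB this hj
  · have : c j ∈ C := by rw [← Finset.mem_coe, ← hC]; exact ⟨j, rfl⟩
    exact Finset.disjoint_left.1 hBC hj this
  · obtain ⟨i, rfl⟩ := hBmem x hx
    exact hab j i
  · obtain ⟨i, rfl⟩ := hBmem x hx
    exact hbc i j

theorem mainTheorem6 :
    ∃ (P : RAMProgram) (c : ℕ),
      ∀ (n m s t : ℕ) (H : MultiDigraph (Fin m) (Fin s)) (u : Fin t → Fin m)
        (T : Digraph (Fin n)) (v : Fin t → Fin n) (A B C : Finset (Fin n))
        (LA LB LC : List (Fin n)),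
        Function.Injective u → Function.Injective v →
        T.IsSemicomplete →
        T.IsTriple (tripleSize (m + s)) A B C →
        (∀ i, v i ∉ A ∧ v i ∉ B ∧ v i ∉ C) →
        LA.Nodup → LA.toFinset = A → LB.Nodup → LB.toFinset = B →
        LC.Nodup → LC.toFinset = C →
        ∃ x ∈ B,
          (∃ (τ : ℕ) (M : ℕ → ℕ),
            RAMExec (encodeInput H u T v LA LB LC) (n ^ c) P (fun _ => 0) τ M ∧
            τ ≤ c * (tripleSize (m + s) ^ 2 * n ^ 2) ∧
            M 0 = x.val) ∧
          ∃ hx : ∀ i, v i ≠ x,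
            (HasRootedImmersion H u T v ↔
              HasRootedImmersion H u (T.deleteVertex x) (fun i => ⟨v i, hx i⟩)) := by
  refine ⟨irrelevantVertexProgram, 200, fun n m s t H u T v A B C LA LB LC _ _ hT htriple hv _ _
    hLB hLB' _ _ => ?_⟩
  obtain ⟨a, c, ht⟩ := htriple.isTripleAround
  have hq : tripleSize (m + s) = 80 * (m + s) ^ 2 + 80 * (m + s) + 5 := rfl
  have hqn : tripleSize (m + s) ≤ n := by simpa [ht.card_eq] using Finset.card_le_univ B
  have hn : 5 ≤ n := by omega
  -- All words that occur are linear in `n`. Since `n ≥ q ≥ 5`, already `n ^ 4` exceeds them; the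
  -- exponent 200 is the constant shared with the time bound.
  have hW : 5 * n + 100 ≤ n ^ 200 := by
    calc 5 * n + 100 ≤ 5 ^ 3 * n := by omega
      _ ≤ n ^ 3 * n := Nat.mul_le_mul_right _ (Nat.pow_le_pow_left hn 3)
      _ = n ^ 4 := (pow_succ n 3).symm
      _ ≤ n ^ 200 := Nat.pow_le_pow_right (by omega) (by norm_num)
  obtain ⟨τ, M, hexec, hτ, x, hxB, hM, hout, hin⟩ :=
    runs_irrelevantVertexProgram H u v LA LB LC hT ht.card_eq hLB hLB' hW
  have hx : ∀ i, v i ≠ x := fun i h => (hv i).2.1 (h ▸ hxB)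
  exact ⟨x, hxB, ⟨τ, M, hexec, hτ, hM⟩, hx, hasRootedImmersion_deleteVertex_iff ht hxB hx
    (by simp; omega) (by simp; omega) (by simp) hout hin⟩
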